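/- Let $N\ge 3$ and let $X=(X_m)_{m\in\mathbb N}$ be a homogeneous Markov chain on $\{1,\dots,N\}$ (with any initial law) whose transition matrix $P$ is irreducible and aperiodic, with invariant distribution $\pi$. Let $Y_k=X_{T_k}$, $k\ge 1$, where $T_1$ is a random time with values in $\mathbb N$, the gaps $\tau_k=T_k-T_{k-1}$, $k\ge 2$, are i.i.d. with a distribution $\mu$ on $\mathbb N$ and independent of $T_1$, and $(T_k)_{k\ge1}$ is independent of $X$. Put $Q=\sum_{l\ge 0}\mu(l)P^l$, the transition matrix of $Y$. For $S\subseteq\{1,\dots,N\}^2$ let $\mathcal A(S)=\{A\in\mathbb R^{N\times N}: A\mathbf 1=\mathbf 1,\ \operatorname{supp}(A)\subseteq S\}$ and $\mathcal A_{\mathrm{lin}}(S)=\{A\in\mathbb R^{N\times N}: A\mathbf 1=0,\ \operatorname{supp}(A)\subseteq S\}$. Assume that the problem is identifiable, i.e. $\mathcal A(S)\cap\operatorname{Com}(Q)=\{P\}$, where $\operatorname{Com}(Q)$ is the set of matrices that commute with $Q$. Let $P_0\in\mathcal A(S)$ be arbitrary, let $\phi_1,\dots,\phi_r$ be any basis of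 $\mathcal A_{\mathrm{lin}}(S)$, and let $\Phi=[\operatorname{vec}(\phi_1),\dots,\operatorname{vec}(\phi_r)]$, $p_0=\operatorname{vec}(P_0)$, $p=\operatorname{vec}(P)$ (column-wise vectorization) and $\Delta(A)=I\otimes A-A^\top\otimes I$. Let $$\hat Q_{ij}=\frac{\sum_{k=1}^{n-1}\mathbf 1\{Y_k=i,\,Y_{k+1}=j\}}{\sum_{k=1}^{n-1}\mathbf 1\{Y_k=i\}}$$ (with $0/0=0$), and $$\hat p=\Big[I-\Phi\big(\Phi^\top\Delta(\hat Q)^\top\Delta(\hat Q)\Phi\big)^{-1}\Phi^\top\Delta(\hat Q)^\top\Delta(\hat Q)\Big]p_0$$ (with the inverse replaced by $0$ where it does not exist). Let $\Sigma$ be the $N^2\times N^2$ matrix, indexed by the entries of $\operatorname{vec}$, with $$\Sigma_{(i,j),(k,l)}=\begin{cases}Q_{ij}(1-Q_{ij})/\pi_i&\text{if }(i,j)=(k,l),\\-Q_{ij}Q_{il}/\pi_i&\text{if }i=k,\ j\ne l,\\0&\text{otherwise.}\end{cases}$$ Then $\Phi^\top\Delta(Q)^\top\Delta(Q)\Phi$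 is invertible; the matrix $\Phi^\top\Delta(\hat Q)^\top\Delta(\hat Q)\Phi$ is invertible with probability tending to $1$ as $n\to\infty$; $\hat p$ is consistent, i.e. $\hat p\to p$ in probability; and $$\sqrt n\,(\hat p-p)\xrightarrow{\ d\ }\mathcal N(0,B\Sigma B^\top),\qquad B=\Phi\big[\Phi^\top\Delta(Q)^\top\Delta(Q)\Phi\big]^{-1}\Phi^\top\Delta(Q)^\top\Delta(P).$$ -/

import Mathlib

open MeasureTheory ProbabilityTheory Filter
open scoped Kronecker Topology

namespace SubsampledChain

noncomputable section

/-- `X` is a homogeneous Markov chain with state space `{1, …, N}` (here `Fin N`), transition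
matrix `P` and arbitrary initial law: given the past, the probability of jumping from the present
state `i` to `j` is `P i j`. -/
structure IsMarkovChain {N : ℕ} {Ω : Type*} [MeasurableSpace Ω] (Pr : Measure Ω)
    (P : Matrix (Fin N) (Fin N) ℝ) (X : ℕ → Ω → Fin N) : Prop where
  measurable : ∀ m, Measurable (X m)
  markov : ∀ (m : ℕ) (x : ℕ → Fin N),
    Pr.real {ω | ∀ k ≤ m + 1, X k ω = x k}
      = Pr.real {ω | ∀ k ≤ m, X k ω = x k} * P (x m) (x (m + 1))

/-- Every state has period one: the only common divisor of the lengths of the possible returns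
is `1`. -/
def IsAperiodic {N : ℕ} (P : Matrix (Fin N) (Fin N) ℝ) : Prop :=
  ∀ (i : Fin N) (d : ℕ), (∀ k : ℕ, 0 < k → 0 < (P ^ k) i i → d ∣ k) → d = 1

/-- `τ 0` is the time of the first observation and `τ k`, for `k ≥ 1`, is the number of jumps
between the `k`-th and the `(k+1)`-st observation. All of these are independent, the gaps `τ k`,
`k ≥ 1`, have common distribution `μ`, and the whole sequence is independent of the chain `X`.
The law of the time `τ 0` of the first observation is arbitrary. -/
structure IsSamplingScheme {N : ℕ} {Ω : Type*} [MeasurableSpace Ω] (Pr : Measure Ω)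
    (μ : PMF ℕ) (X : ℕ → Ω → Fin N) (τ : ℕ → Ω → ℕ) : Prop where
  measurable : ∀ k, Measurable (τ k)
  iIndep : iIndepFun τ Pr
  law : ∀ k, 1 ≤ k → ∀ l : ℕ, Pr {ω | τ k ω = l} = μ l
  indep_chain : IndepFun (fun ω (k : ℕ) => τ k ω) (fun ω (m : ℕ) => X m ω) Pr

/-- Observation times: `obsTime τ k` is the time of the `(k+1)`-st observation. -/
def obsTime {Ω : Type*} (τ : ℕ → Ω → ℕ) (k : ℕ) (ω : Ω) : ℕ :=
  ∑ i ∈ Finset.range (k + 1), τ i ω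

/-- The observed sequence, numbered from `0`: a sample of size `n` is `Y 0, …, Y (n - 1)`. -/
def observed {N : ℕ} {Ω : Type*} (X : ℕ → Ω → Fin N) (τ : ℕ → Ω → ℕ) (k : ℕ) (ω : Ω) : Fin N :=
  X (obsTime τ k ω) ω

/-- `Q = ∑_{l ≥ 0} μ(l) P ^ l`, the generating function of `μ` at `P` (the series converges
absolutely when `P` is stochastic). -/
def genMatrix {N : ℕ} (μ : PMF ℕ) (P : Matrix (Fin N) (Fin N) ℝ) : Matrix (Fin N) (Fin N) ℝ :=
  Matrix.of fun i j => ∑' l : ℕ, (μ l).toReal * (P ^ l) i j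

/-- `𝒜(S)`: matrices with unit row sums, supported in `S`. -/
def affineSet {N : ℕ} (S : Set (Fin N × Fin N)) : Set (Matrix (Fin N) (Fin N) ℝ) :=
  {A | A.mulVec 1 = 1 ∧ {ij : Fin N × Fin N | A ij.1 ij.2 ≠ 0} ⊆ S}

/-- `𝒜_lin(S)`: matrices with zero row sums, supported in `S`. -/
def linSpace {N : ℕ} (S : Set (Fin N × Fin N)) : Submodule ℝ (Matrix (Fin N) (Fin N) ℝ) where
  carrier := {A | A.mulVec 1 = 0 ∧ {ij : Fin N × Fin N | A ij.1 ij.2 ≠ 0} ⊆ S}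
  zero_mem' := by simp
  add_mem' := by
    rintro A B ⟨hA, hA'⟩ ⟨hB, hB'⟩
    refine ⟨by rw [Matrix.add_mulVec, hA, hB, add_zero], fun ij hij => ?_⟩
    by_contra hS
    have h1 : A ij.1 ij.2 = 0 := not_not.1 fun h => hS (hA' h)
    have h2 : B ij.1 ij.2 = 0 := not_not.1 fun h => hS (hB' h)
    exact hij (by simp [h1, h2])
  smul_mem' := by
    rintro c A ⟨hA, hA'⟩
    refine ⟨by rw [Matrix.smul_mulVec, hA, smul_zero], fun ij hij => hA' fun h => hij ?_⟩
    simp [h]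

/-- The problem is identifiable: `𝒜(S) ∩ Com(Q) = {P}`, where `Com(Q)` is the commutant. -/
def Identifiable {N : ℕ} (S : Set (Fin N × Fin N)) (P Q : Matrix (Fin N) (Fin N) ℝ) : Prop :=
  affineSet S ∩ Set.centralizer {Q} = {P}

/-- `Δ(A) = I ⊗ A - Aᵀ ⊗ I`, the matrix of `vec M ↦ vec (A M - M A)`. -/
def Delta {N : ℕ} (A : Matrix (Fin N) (Fin N) ℝ) :
    Matrix (Fin N × Fin N) (Fin N × Fin N) ℝ :=
  (1 : Matrix (Fin N) (Fin N) ℝ) ⊗ₖ A - A.transpose ⊗ₖ (1 : Matrix (Fin N) (Fin N) ℝ)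

/-- `Φ`: its columns are the vectorized elements of the basis `φ`. -/
def PhiMat {N r : ℕ} {S : Set (Fin N × Fin N)} (φ : Module.Basis (Fin r) ℝ (linSpace S)) :
    Matrix (Fin N × Fin N) (Fin r) ℝ :=
  Matrix.of fun x j => Matrix.vec (φ j : Matrix (Fin N) (Fin N) ℝ) x

/-- `Φᵀ Δ(A)ᵀ Δ(A) Φ`. -/
def gram {N r : ℕ} {S : Set (Fin N × Fin N)} (φ : Module.Basis (Fin r) ℝ (linSpace S))
    (A : Matrix (Fin N) (Fin N) ℝ) : Matrix (Fin r) (Fin r) ℝ :=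
  (PhiMat φ).transpose * (Delta A).transpose * Delta A * PhiMat φ

/-- Empirical transition matrix of a sample `Y 0, …, Y (n - 1)`:
the number of observed transitions `i → j` over the number of observed transitions from `i`. -/
def empirical {N : ℕ} {Ω : Type*} (Y : ℕ → Ω → Fin N) (n : ℕ) (ω : Ω) :
    Matrix (Fin N) (Fin N) ℝ :=
  Matrix.of fun i j =>
    (∑ k ∈ Finset.range (n - 1), if Y k ω = i ∧ Y (k + 1) ω = j then (1 : ℝ) else 0) /
      (∑ k ∈ Finset.range (n - 1), if Y k ω = i then (1 : ℝ) else 0)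

/-- `[I - Φ (Φᵀ Δ(A)ᵀ Δ(A) Φ)⁻¹ Φᵀ Δ(A)ᵀ Δ(A)] vec P₀`; the estimator is the value at the
empirical transition matrix. -/
def estimator {N r : ℕ} {S : Set (Fin N × Fin N)} (φ : Module.Basis (Fin r) ℝ (linSpace S))
    (P₀ A : Matrix (Fin N) (Fin N) ℝ) : EuclideanSpace ℝ (Fin N × Fin N) :=
  WithLp.toLp 2
    ((1 - PhiMat φ * (gram φ A)⁻¹ * (PhiMat φ).transpose * (Delta A).transpose * Delta A).mulVec
      (Matrix.vec P₀))

/-- `Σ`, the asymptotic covariance matrix of `vec Q̂`: the entry at the pair of positions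
`(i, j)`, `(k, l)` is `Q i j (1 - Q i j) / π i` if `(i, j) = (k, l)`, is `- Q i j Q i l / π i` if
`i = k` and `j ≠ l`, and is zero otherwise.
In `vec A` the entry `A i j` has the index `(j, i)`. -/
def SigmaMat {N : ℕ} (π : Fin N → ℝ) (Q : Matrix (Fin N) (Fin N) ℝ) :
    Matrix (Fin N × Fin N) (Fin N × Fin N) ℝ :=
  Matrix.of fun x y =>
    if x = y then Q x.2 x.1 * (1 - Q x.2 x.1) / π x.2
    else if x.2 = y.2 then -(Q x.2 x.1 * Q x.2 y.1) / π x.2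
    else 0

/-- `B = Φ (Φᵀ Δ(Q)ᵀ Δ(Q) Φ)⁻¹ Φᵀ Δ(Q)ᵀ Δ(P)`. -/
def BMat {N r : ℕ} {S : Set (Fin N × Fin N)} (φ : Module.Basis (Fin r) ℝ (linSpace S))
    (P Q : Matrix (Fin N) (Fin N) ℝ) : Matrix (Fin N × Fin N) (Fin N × Fin N) ℝ :=
  PhiMat φ * (gram φ Q)⁻¹ * (PhiMat φ).transpose * (Delta Q).transpose * Delta P

end

end SubsampledChain

/-! The argument separates probability from algebra. Since the gaps are i.i.d. and independent of
`X`, the sequence `Y` is a Markov chain with matrix `Q` (`isMarkovChain_observed`). If `μ 0 ≠ 1`,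
then `Q` inherits from `P` the invariant law `π` and a strictly positive power.

For such a `Q` the Poisson equation `h - Q h = g` is solvable whenever `g` is `π`-centred
(`exists_poisson`). Its solution turns a sum over transitions into a martingale plus a bounded
telescoping term, whence a weak law by second moments. Applied to conditional variances, it corrects
the recursion for characteristic functions up to third order, whence a central limit theorem from
any initial law. Projections then give joint normality of the transition counts, with covariance `Σ`
after division by `π`.

On the algebraic side, a kernel vector of the Gram matrix at `Q` would give a direction `D` with `P
+ D` still admissible and commuting with `Q`, so identifiability makes this matrix invertible
(`isUnit_gram`). Where the Gram matrix at `A` is invertible, the estimator does not depend on the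
base point, and `Q P = P Q` gives the exact identity `p̂ - p = B(A) vec (A - Q)` (`estimator_sub`).
With `A` the empirical matrix, continuity at `Q` and Slutsky's theorem conclude.

If `μ 0 = 1`, then `Q = 1` is not ergodic, but everything commutes with it, so identifiability
forces `r = 0` and the estimator is constant. -/

namespace SubsampledChain

/-! ### Primitive stochastic matrices, the Poisson equation, and the matrix `Q` -/

section Stochastic

variable {N : ℕ} {P Q : Matrix (Fin N) (Fin N) ℝ} {π : Fin N → ℝ}

lemma pow_pos_add (hP : ∀ i j, 0 ≤ P i j) {a b : ℕ} {i j k : Fin N}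
    (h₁ : 0 < (P ^ a) i j) (h₂ : 0 < (P ^ b) j k) : 0 < (P ^ (a + b)) i k := by
  rw [pow_add, Matrix.mul_apply]
  exact Finset.sum_pos' (fun x _ => mul_nonneg (Matrix.pow_apply_nonneg hP _ _ _)
    (Matrix.pow_apply_nonneg hP _ _ _)) ⟨j, Finset.mem_univ _, mul_pos h₁ h₂⟩

/-- An irreducible aperiodic matrix has eventually positive powers. -/
lemma eventually_pow_pos (hirr : P.IsIrreducible) (haper : IsAperiodic P) :
    ∃ K, ∀ k ≥ K, ∀ i j, 0 < (P ^ k) i j := by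
  have hP := hirr.nonneg
  have hloop : ∀ i : Fin N, ∃ K, ∀ k ≥ K, 0 < (P ^ k) i i := by
    intro i
    let s : Set ℕ := {k | 0 < k ∧ 0 < (P ^ k) i i}
    -- All large multiples of the gcd of a set of integers lie in the additive monoid it generates.
    -- Here the gcd is one, and return times are closed under addition.
    obtain ⟨n, hn⟩ := Nat.exists_mem_closure_of_ge (s := s)
    have hs : Nat.setGcd s = 1 :=
      haper i _ fun k hk hk' => Nat.setGcd_dvd_of_mem ⟨hk, hk'⟩
    refine ⟨n, fun k hk => ?_⟩
    have hmem := hn k hk (hs ▸ one_dvd k)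
    clear hk
    induction hmem using AddSubmonoid.closure_induction with
    | mem x hx => exact hx.2
    | zero => simp
    | add x y _ _ hx hy => exact pow_pos_add hP hx hy
  choose K hK using hloop
  choose d _ hd using (Matrix.isIrreducible_iff_exists_pow_pos hP).1 hirr
  -- The sums serve as crude maxima: a loop at `i` of length `k - d i j` is followed by a path of
  -- length `d i j` to `j`.
  refine ⟨(∑ i, K i) + ∑ i, ∑ j, d i j, fun k hk i j => ?_⟩
  have h₁ : K i ≤ ∑ i, K i := Finset.single_le_sum (fun _ _ => Nat.zero_le _) (Finset.mem_univ i)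
  have h₂ : d i j ≤ ∑ i, ∑ j, d i j :=
    (Finset.single_le_sum (f := d i) (fun _ _ => Nat.zero_le _) (Finset.mem_univ j)).trans
      (Finset.single_le_sum (f := fun i => ∑ j, d i j) (fun _ _ => Nat.zero_le _)
        (Finset.mem_univ i))
  have := pow_pos_add hP (hK i (k - d i j) (by omega)) (hd i j)
  rwa [Nat.sub_add_cancel (by omega)] at this

lemma invariant_pow (hπP : Matrix.vecMul π P = π) (k : ℕ) : Matrix.vecMul π (P ^ k) = π := by
  induction k with
  | zero => simp
  | succ k ih => rw [pow_succ, ← Matrix.vecMul_vecMul, ih, hπP]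

lemma invariant_pos (hπ : π ∈ stdSimplex ℝ (Fin N)) (hπP : Matrix.vecMul π P = π)
    {k : ℕ} (hk : ∀ i j, 0 < (P ^ k) i j) (j : Fin N) : 0 < π j := by
  have h := congrFun (invariant_pow hπP k) j
  rw [← h]
  obtain ⟨i, hi⟩ : ∃ i, 0 < π i := by
    by_contra! hc
    have := hπ.2
    have h0 : ∑ i, π i ≤ 0 := Finset.sum_nonpos fun i _ => hc i
    linarith
  exact Finset.sum_pos' (fun x _ => mul_nonneg (hπ.1 x) (hk x j).le)
    ⟨i, Finset.mem_univ _, mul_pos hi (hk i j)⟩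

lemma pow_mulVec_eq_self {h : Fin N → ℝ} (hh : Q.mulVec h = h) (k : ℕ) :
    (Q ^ k).mulVec h = h := by
  induction k with
  | zero => simp
  | succ k ih => rw [pow_succ, ← Matrix.mulVec_mulVec, hh, ih]

/-- Harmonic functions of a primitive stochastic matrix are constant. -/
lemma harmonic_const (hQ : Q ∈ Matrix.rowStochastic ℝ (Fin N))
    {k : ℕ} (hk : ∀ i j, 0 < (Q ^ k) i j) {h : Fin N → ℝ} (hh : Q.mulVec h = h) (a b : Fin N) :
    h a = h b := by
  have hne : (Finset.univ : Finset (Fin N)).Nonempty := ⟨a, Finset.mem_univ _⟩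
  obtain ⟨i, -, hi⟩ := Finset.exists_max_image Finset.univ h hne
  have hQk : Q ^ k ∈ Matrix.rowStochastic ℝ (Fin N) := pow_mem hQ k
  -- Maximum principle: at a maximum point `i` of `h`, a strictly positive average of the
  -- nonnegative gaps `h i - h j` vanishes.
  have hsum : ∑ j, (Q ^ k) i j * (h i - h j) = 0 := by
    have h1 := congrFun (pow_mulVec_eq_self hh k) i
    simp only [Matrix.mulVec, dotProduct] at h1
    simp only [mul_sub, Finset.sum_sub_distrib, ← Finset.sum_mul,
      Matrix.sum_row_of_mem_rowStochastic hQk i, h1]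
    ring
  have hall : ∀ j, h j = h i := by
    intro j
    have := (Finset.sum_eq_zero_iff_of_nonneg (fun j _ => mul_nonneg (hk i j).le
      (sub_nonneg.2 (hi j (Finset.mem_univ _))))).1 hsum j (Finset.mem_univ _)
    rcases mul_eq_zero.1 this with h0 | h0
    · exact absurd h0 (hk i j).ne'
    · linarith
  rw [hall a, hall b]

/-- Solvability of the Poisson equation of a primitive stochastic matrix. -/
lemma exists_poisson (hQ : Q ∈ Matrix.rowStochastic ℝ (Fin N))
    {k : ℕ} (hk : ∀ i j, 0 < (Q ^ k) i j)
    (hπ : π ∈ stdSimplex ℝ (Fin N)) (hπQ : Matrix.vecMul π Q = π)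
    {g : Fin N → ℝ} (hg : π ⬝ᵥ g = 0) :
    ∃ h : Fin N → ℝ, ∀ i, h i - ∑ j, Q i j * h j = g i := by
  have hπ1 : π ⬝ᵥ (1 : Fin N → ℝ) = 1 := by simpa [dotProduct] using hπ.2
  -- The rank-one term removes the kernel of `1 - Q`, which consists of constants. As `T` preserves
  -- the pairing with `π`, that term vanishes on any preimage of a centred `g`.
  let T : (Fin N → ℝ) →ₗ[ℝ] (Fin N → ℝ) :=
    { toFun := fun h => h - Q.mulVec h + (π ⬝ᵥ h) • 1
      map_add' := fun x y => by
        ext i; simp [Matrix.mulVec_add, dotProduct_add]; ring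
      map_smul' := fun c x => by
        ext i; simp [Matrix.mulVec_smul, dotProduct_smul]; ring }
  have hT : ∀ h, π ⬝ᵥ T h = π ⬝ᵥ h := by
    intro h
    change π ⬝ᵥ (h - Q.mulVec h + (π ⬝ᵥ h) • 1) = _
    rw [dotProduct_add, dotProduct_sub, dotProduct_smul, hπ1, Matrix.dotProduct_mulVec, hπQ]
    simp
  have hzero : ∀ h, π ⬝ᵥ T h = 0 → T h = h - Q.mulVec h := by
    intro h h0
    rw [hT] at h0
    change h - Q.mulVec h + (π ⬝ᵥ h) • 1 = _
    simp [h0]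
  have hinj : Function.Injective T := by
    rw [← LinearMap.ker_eq_bot, LinearMap.ker_eq_bot']
    intro h h0
    have h1 : Q.mulVec h = h := by
      have := hzero h (by simp [h0])
      rw [h0] at this
      exact (sub_eq_zero.1 this.symm).symm
    have h2 : π ⬝ᵥ h = 0 := by rw [← hT, h0]; simp
    ext i
    have h3 : π ⬝ᵥ h = h i := by
      have : h = h i • (1 : Fin N → ℝ) := by
        ext j; simp [harmonic_const hQ hk h1 j i]
      rw [this, dotProduct_smul, hπ1]; simp
    simpa [h2] using h3.symm
  obtain ⟨h, rfl⟩ := (LinearMap.injective_iff_surjective.1 hinj) g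
  refine ⟨h, fun i => ?_⟩
  rw [hzero h hg]
  simp [Matrix.mulVec, dotProduct]

/-- Serves to transfer positivity of powers from a single term `μ(l) P ^ l` of the series to `Q`. -/
lemma pow_lower_bound {A B : Matrix (Fin N) (Fin N) ℝ} (hA : ∀ i j, 0 ≤ A i j) {c : ℝ} (hc : 0 ≤ c)
    (h : ∀ i j, c * A i j ≤ B i j) (m : ℕ) (i j : Fin N) :
    c ^ m * (A ^ m) i j ≤ (B ^ m) i j := by
  induction m generalizing i j with
  | zero => simp
  | succ m ih =>
    rw [pow_succ, pow_succ, pow_succ, Matrix.mul_apply, Matrix.mul_apply, Finset.mul_sum]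
    refine Finset.sum_le_sum fun k _ => ?_
    calc c ^ m * c * ((A ^ m) i k * A k j) = (c ^ m * (A ^ m) i k) * (c * A k j) := by ring
      _ ≤ _ := mul_le_mul (ih i k) (h k j) (mul_nonneg hc (hA _ _))
        (le_trans (mul_nonneg (pow_nonneg hc m) (Matrix.pow_apply_nonneg hA _ _ _)) (ih i k))

variable {μ : PMF ℕ}

lemma hasSum_pmf_toReal (μ : PMF ℕ) : HasSum (fun l => (μ l).toReal) 1 := by
  have h : ∑' l, (μ l).toReal = 1 := by
    rw [← ENNReal.tsum_toReal_eq fun l => μ.apply_ne_top l, μ.tsum_coe, ENNReal.toReal_one]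
  rw [← h]
  exact (ENNReal.summable_toReal (by simp [μ.tsum_coe])).hasSum

lemma hasSum_genMatrix (hP : P ∈ Matrix.rowStochastic ℝ (Fin N)) (i j : Fin N) :
    HasSum (fun l : ℕ => (μ l).toReal * (P ^ l) i j) (genMatrix μ P i j) := by
  refine Summable.hasSum (Summable.of_nonneg_of_le (fun l => ?_) (fun l => ?_)
    (hasSum_pmf_toReal μ).summable)
  · exact mul_nonneg ENNReal.toReal_nonneg (Matrix.nonneg_of_mem_rowStochastic (pow_mem hP l))
  · exact mul_le_of_le_one_right ENNReal.toReal_nonneg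
      (Matrix.le_one_of_mem_rowStochastic (pow_mem hP l))

lemma genMatrix_mem_rowStochastic (hP : P ∈ Matrix.rowStochastic ℝ (Fin N)) :
    genMatrix μ P ∈ Matrix.rowStochastic ℝ (Fin N) := by
  rw [Matrix.mem_rowStochastic_iff_sum]
  refine ⟨fun i j => (hasSum_genMatrix hP i j).nonneg fun l => mul_nonneg ENNReal.toReal_nonneg
    (Matrix.nonneg_of_mem_rowStochastic (pow_mem hP l)), fun i => ?_⟩
  have h := hasSum_sum (s := Finset.univ) fun j _ => hasSum_genMatrix (μ := μ) hP i j
  refine h.unique ?_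
  simp only [← Finset.mul_sum, Matrix.sum_row_of_mem_rowStochastic (pow_mem hP _), mul_one]
  exact hasSum_pmf_toReal μ

lemma invariant_genMatrix (hP : P ∈ Matrix.rowStochastic ℝ (Fin N))
    (hπP : Matrix.vecMul π P = π) : Matrix.vecMul π (genMatrix μ P) = π := by
  ext j
  have h := hasSum_sum (s := Finset.univ) fun i _ =>
    (hasSum_genMatrix (μ := μ) hP i j).mul_left (π i)
  refine h.unique ?_
  have h2 : ∀ l : ℕ, ∑ i, π i * ((μ l).toReal * (P ^ l) i j) = (μ l).toReal * π j := by
    intro l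
    conv_rhs => rw [← invariant_pow hπP l]
    simp only [Matrix.vecMul, dotProduct, Finset.mul_sum]
    exact Finset.sum_congr rfl fun i _ => by ring
  simp only [h2]
  simpa using (hasSum_pmf_toReal μ).mul_right (π j)

/-- Some `l > 0` carries mass, and `Q` dominates `μ(l) P ^ l` entrywise. The `K`-th power of this
term is positive because `l * K ≥ K`. -/
lemma genMatrix_pow_pos (hP : P ∈ Matrix.rowStochastic ℝ (Fin N)) (hirr : P.IsIrreducible)
    (haper : IsAperiodic P) (hμ : μ 0 ≠ 1) : ∃ k, ∀ i j, 0 < (genMatrix μ P ^ k) i j := by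
  obtain ⟨l, hl, hμl⟩ : ∃ l, 0 < l ∧ μ l ≠ 0 := by
    by_contra! hc
    apply hμ
    rw [← μ.tsum_coe, tsum_eq_single 0]
    exact fun l hl => hc l (Nat.pos_of_ne_zero hl)
  obtain ⟨K, hK⟩ := eventually_pow_pos hirr haper
  have hc : 0 < (μ l).toReal := ENNReal.toReal_pos hμl (μ.apply_ne_top l)
  refine ⟨K, fun i j => ?_⟩
  refine lt_of_lt_of_le ?_ (pow_lower_bound (A := P ^ l) (c := (μ l).toReal)
    (fun i j => Matrix.nonneg_of_mem_rowStochastic (pow_mem hP l)) hc.le (fun i j => ?_) K i j)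
  · refine mul_pos (pow_pos hc K) ?_
    rw [← pow_mul]
    exact hK _ (Nat.le_mul_of_pos_left K hl) i j
  · exact le_hasSum (hasSum_genMatrix hP i j) l fun m _ => mul_nonneg ENNReal.toReal_nonneg
      (Matrix.nonneg_of_mem_rowStochastic (pow_mem hP m))

lemma genMatrix_eq_one (hμ : μ 0 = 1) : genMatrix μ P = 1 := by
  have h0 : ∀ l, l ≠ 0 → μ l = 0 := by
    intro l hl
    by_contra h
    exact hl ((PMF.apply_eq_one_iff μ 0).1 hμ ▸ (PMF.mem_support_iff μ l).2 h :)
  ext i j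
  change ∑' l : ℕ, (μ l).toReal * (P ^ l) i j = _
  rw [tsum_eq_single 0 fun l hl => by simp [h0 l hl]]
  simp [hμ]

end Stochastic


/-! ### Functionals of finitely many steps and the Markov property -/

section Paths

variable {N : ℕ} {Ω : Type*} [MeasurableSpace Ω] {Y : ℕ → Ω → Fin N}

/-- The function of the whole path that only looks at the times `0, …, k`. -/
lemma dependsOn_truncate {β : Type*} {k : ℕ} {G : (ℕ → Fin N) → β}
    (hG : DependsOn G (Set.Iic k)) (x : ℕ → Fin N) :
    G x = G fun m => (fun i : Fin (k + 1) => x i) (Fin.ofNat (k + 1) m) := by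
  -- `Fin.ofNat` reduces modulo `k + 1`, which changes nothing at the times up to `k`; the later
  -- values are never read.
  refine hG fun m hm => ?_
  have : m % (k + 1) = m := Nat.mod_eq_of_lt (Nat.lt_succ_of_le hm)
  simp [Fin.ofNat, this]

/-- The functional factors through the finite space of paths of length `k + 1`, on which every
function is measurable. -/
lemma measurable_of_dependsOn (hY : ∀ m, Measurable (Y m)) {β : Type*} [MeasurableSpace β] {k : ℕ}
    {G : (ℕ → Fin N) → β} (hG : DependsOn G (Set.Iic k)) :
    Measurable fun ω => G fun m => Y m ω := by
  rw [show (fun ω => G fun m => Y m ω) = _ from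
    funext fun ω => dependsOn_truncate hG fun m => Y m ω]
  exact (measurable_of_finite fun z : Fin (k + 1) → Fin N =>
    G fun m => z (Fin.ofNat (k + 1) m)).comp (measurable_pi_lambda _ fun i => hY i)

variable {E : Type*} [NormedAddCommGroup E]

lemma integrable_of_dependsOn (hY : ∀ m, Measurable (Y m)) {Pr : Measure Ω} [IsFiniteMeasure Pr]
    {k : ℕ} {G : (ℕ → Fin N) → E} (hG : DependsOn G (Set.Iic k)) :
    Integrable (fun ω => G fun m => Y m ω) Pr := by
  rw [show (fun ω => G fun m => Y m ω) = _ from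
    funext fun ω => dependsOn_truncate hG fun m => Y m ω]
  exact (Integrable.of_finite (μ := Pr.map fun ω (i : Fin (k + 1)) => Y i ω)
    (f := fun z : Fin (k + 1) → Fin N => G fun m => z (Fin.ofNat (k + 1) m))).comp_measurable
    (measurable_pi_lambda _ fun i => hY i)

variable [NormedSpace ℝ E] [CompleteSpace E]

lemma integral_comp_finite {α : Type*} [Fintype α] [MeasurableSpace α] [MeasurableSingletonClass α]
    {Pr : Measure Ω} [IsFiniteMeasure Pr] {Z : Ω → α} (hZ : Measurable Z) (g : α → E) :
    ∫ ω, g (Z ω) ∂Pr = ∑ z, Pr.real {ω | Z ω = z} • g z := by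
  rw [← integral_map (f := g) hZ.aemeasurable (StronglyMeasurable.of_discrete).aestronglyMeasurable,
    integral_fintype Integrable.of_finite]
  refine Finset.sum_congr rfl fun z _ => ?_
  rw [map_measureReal_apply hZ (measurableSet_singleton z)]
  rfl

/-- One-step conditional expectations along a Markov chain. -/
lemma integral_markov_step {Pr : Measure Ω} [IsProbabilityMeasure Pr]
    {Q : Matrix (Fin N) (Fin N) ℝ} (hY : IsMarkovChain Pr Q Y) {k : ℕ}
    {H : (ℕ → Fin N) → Fin N → E} (hH : ∀ j, DependsOn (fun x => H x j) (Set.Iic k)) :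
    ∫ ω, H (fun m => Y m ω) (Y (k + 1) ω) ∂Pr
      = ∫ ω, ∑ j, Q (Y k ω) j • H (fun m => Y m ω) j ∂Pr := by
  let ext' : (Fin (k + 1) → Fin N) → ℕ → Fin N := fun z m => z (Fin.ofNat (k + 1) m)
  have hpath : Measurable fun ω (i : Fin (k + 1)) => Y i ω :=
    measurable_pi_lambda _ fun i => hY.measurable i
  have h1 : ∀ ω, H (fun m => Y m ω) (Y (k + 1) ω)
      = H (ext' fun i : Fin (k + 1) => Y i ω) (Y (k + 1) ω) := fun ω =>
    dependsOn_truncate (hH (Y (k + 1) ω)) fun m => Y m ω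
  have h2 : ∀ ω, ∑ j, Q (Y k ω) j • H (fun m => Y m ω) j
      = ∑ j, Q (Y (Fin.last k) ω) j • H (ext' fun i : Fin (k + 1) => Y i ω) j := fun ω =>
    Finset.sum_congr rfl fun j _ => by
      rw [show H (fun m => Y m ω) j = _ from dependsOn_truncate (hH j) fun m => Y m ω]
      rfl
  simp_rw [h1, h2]
  -- Both sides become finite sums over initial paths `z`, to be matched term by term.
  rw [integral_comp_finite (Z := fun ω => ((fun i : Fin (k + 1) => Y i ω), Y (k + 1) ω))
      (hpath.prodMk (hY.measurable _)) fun z => H (ext' z.1) z.2,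
    integral_comp_finite hpath fun z => ∑ j, Q (z (Fin.last k)) j • H (ext' z) j,
    Fintype.sum_prod_type]
  refine Finset.sum_congr rfl fun z _ => ?_
  rw [Finset.smul_sum]
  refine Finset.sum_congr rfl fun j _ => ?_
  rw [smul_smul]
  congr 1
  -- The Markov property is used for the path that follows `z` up to time `k` and sits at `j`
  -- afterwards.
  have h := hY.markov k fun m => if m ≤ k then ext' z m else j
  have hz : ∀ ω, (∀ m ≤ k, Y m ω = ext' z m) ↔ (fun i : Fin (k + 1) => Y i ω) = z := by
    intro ω
    rw [funext_iff]
    refine ⟨fun h i => (h i (Nat.le_of_lt_succ i.2)).trans (by simp [ext']), fun h m hm => ?_⟩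
    have := h (Fin.ofNat (k + 1) m)
    simpa [Nat.mod_eq_of_lt (Nat.lt_succ_of_le hm), ext'] using this
  have e1 : {ω | ((fun i : Fin (k + 1) => Y i ω), Y (k + 1) ω) = (z, j)}
      = {ω | ∀ m ≤ k + 1, Y m ω = if m ≤ k then ext' z m else j} := by
    ext ω
    simp only [Set.mem_ofPred_eq, Prod.mk.injEq, ← hz]
    constructor
    · rintro ⟨h1, h2⟩ m hm
      rcases Nat.le_succ_iff.1 hm with h | h
      · simp [h, h1 m h]
      · simp [h, h2]
    · intro h
      refine ⟨fun m hm => ?_, ?_⟩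
      · simpa [hm] using h m (by omega)
      · simpa using h (k + 1) le_rfl
  have e2 : {ω | (fun i : Fin (k + 1) => Y i ω) = z}
      = {ω | ∀ m ≤ k, Y m ω = if m ≤ k then ext' z m else j} := by
    ext ω
    simp only [Set.mem_ofPred_eq, ← hz]
    exact forall₂_congr fun m hm => by simp [hm]
  rw [e1, e2, h]
  have e3 : ext' z k = z (Fin.last k) := by
    simp [ext', Fin.ofNat, Fin.last]
  simp [e3]

/-- Integrating out the last step replaces `g` by `P g`, so the induction on `l` must allow `g` to
vary. -/
lemma integral_markov_multistep {Pr : Measure Ω} [IsProbabilityMeasure Pr]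
    {P : Matrix (Fin N) (Fin N) ℝ} (hY : IsMarkovChain Pr P Y) {k : ℕ}
    {H : (ℕ → Fin N) → ℝ} (hH : DependsOn H (Set.Iic k)) (l : ℕ) (g : Fin N → ℝ) :
    ∫ ω, H (fun m => Y m ω) * g (Y (k + l) ω) ∂Pr
      = ∫ ω, H (fun m => Y m ω) * (P ^ l).mulVec g (Y k ω) ∂Pr := by
  induction l generalizing g with
  | zero => simp
  | succ l ih =>
    have h := integral_markov_step hY (k := k + l) (H := fun x j => H x * g j) fun j x y hxy => by
      simp only
      rw [hH fun i hi => hxy i (Set.mem_Iic.2 (le_trans hi (Nat.le_add_right k l)))]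
    rw [← add_assoc, h, pow_succ, ← Matrix.mulVec_mulVec, ← ih]
    congr 1 with ω
    simp only [Matrix.mulVec, dotProduct, Finset.mul_sum, smul_eq_mul]
    exact Finset.sum_congr rfl fun j _ => by ring

/-- The case of frozen observation times. Monotonicity makes the earlier observations a functional
of the path up to `T k`. Repeated times are allowed and contribute `P ^ 0 = 1`. -/
lemma measureReal_path_at_times {Pr : Measure Ω} [IsProbabilityMeasure Pr]
    {P : Matrix (Fin N) (Fin N) ℝ} (hY : IsMarkovChain Pr P Y) (T : ℕ → ℕ) (hT : Monotone T)
    (k : ℕ) (y : ℕ → Fin N) :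
    Pr.real {ω | ∀ i ≤ k + 1, Y (T i) ω = y i}
      = Pr.real {ω | ∀ i ≤ k, Y (T i) ω = y i}
        * (P ^ (T (k + 1) - T k)) (y k) (y (k + 1)) := by
  classical
  have hmeas : ∀ k, MeasurableSet {ω | ∀ i ≤ k, Y (T i) ω = y i} := fun k => by
    have : {ω | ∀ i ≤ k, Y (T i) ω = y i} = ⋂ i ≤ k, Y (T i) ⁻¹' {y i} := by ext; simp
    rw [this]
    exact MeasurableSet.iInter fun i => MeasurableSet.iInter fun _ =>
      hY.measurable _ (measurableSet_singleton _)
  obtain ⟨l, hl⟩ := Nat.exists_eq_add_of_le (hT (Nat.le_succ k))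
  rw [Nat.succ_eq_add_one] at hl
  let H : (ℕ → Fin N) → ℝ := fun x => if ∀ i ≤ k, x (T i) = y i then 1 else 0
  have hH : DependsOn H (Set.Iic (T k)) := by
    intro x x' hxx'
    have : (∀ i ≤ k, x (T i) = y i) ↔ ∀ i ≤ k, x' (T i) = y i :=
      forall₂_congr fun i hi => by rw [hxx' (T i) (hT hi)]
    simp [H, this]
  have h := integral_markov_multistep hY hH l fun j => if j = y (k + 1) then 1 else 0
  rw [hl, Nat.add_sub_cancel_left]
  calc Pr.real {ω | ∀ i ≤ k + 1, Y (T i) ω = y i}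
      = ∫ ω, H (fun m => Y m ω) * (if Y (T k + l) ω = y (k + 1) then 1 else 0) ∂Pr := by
        rw [← integral_indicator_one (hmeas (k + 1))]
        congr 1 with ω
        simp only [Set.indicator, Set.mem_ofPred_eq, Pi.one_apply, H, Nat.le_succ_iff,
          or_imp, forall_and, forall_eq, ← hl]
        split_ifs <;> simp_all
    _ = ∫ ω, H (fun m => Y m ω) * (P ^ l) (y k) (y (k + 1)) ∂Pr := by
        rw [h]
        congr 1 with ω
        simp only [H]
        split_ifs with h0
        · simp [Matrix.mulVec, dotProduct, h0 k le_rfl]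
        · simp
    _ = _ := by
        rw [integral_mul_const, ← integral_indicator_one (hmeas k)]
        congr 1
        congr 1 with ω
        simp [H, Set.indicator]

end Paths

/-! ### The chain seen at random times -/

section Observed

variable {N : ℕ} {Ω : Type*} [MeasurableSpace Ω] {Pr : Measure Ω} [IsProbabilityMeasure Pr]
  {P : Matrix (Fin N) (Fin N) ℝ} {X : ℕ → Ω → Fin N} {μ : PMF ℕ} {τ : ℕ → Ω → ℕ}

/-- The time takes countably many values, so one splits according to its value. -/
lemma measurable_eval_at {N : ℕ} {T : (ℕ → ℕ) → ℕ} (hT : Measurable T) :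
    Measurable fun p : (ℕ → ℕ) × (ℕ → Fin N) => p.2 (T p.1) := by
  refine measurable_to_countable' fun j => ?_
  have : (fun p : (ℕ → ℕ) × (ℕ → Fin N) => p.2 (T p.1)) ⁻¹' {j}
      = ⋃ m, (fun p => T p.1) ⁻¹' {m} ∩ (fun p => p.2 m) ⁻¹' {j} := by ext; simp
  rw [this]
  exact MeasurableSet.iUnion fun m =>
    ((hT.comp measurable_fst) (measurableSet_singleton m)).inter
      (((measurable_pi_apply m).comp measurable_snd) (measurableSet_singleton j))

lemma measurable_partialSum (k : ℕ) :
    Measurable fun t : ℕ → ℕ => ∑ i ∈ Finset.range (k + 1), t i :=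
  Finset.measurable_sum _ fun i _ => measurable_pi_apply i

lemma measurable_observed (hX : ∀ m, Measurable (X m)) (hτ : ∀ k, Measurable (τ k)) (k : ℕ) :
    Measurable (observed X τ k) :=
  (measurable_eval_at (measurable_partialSum k)).comp
    ((measurable_pi_lambda _ hτ).prodMk (measurable_pi_lambda _ hX))

/-- The probability of an observed path, by conditioning on the observation times. -/
lemma measureReal_observed_path (hX : ∀ m, Measurable (X m)) (hτ : IsSamplingScheme Pr μ X τ)
    (k : ℕ) (y : ℕ → Fin N) :
    Pr.real {ω | ∀ i ≤ k, observed X τ i ω = y i}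
      = ∫ ω, Pr.real {ω' | ∀ i ≤ k, X (obsTime τ i ω) ω' = y i} ∂Pr := by
  have mτ : Measurable fun ω (k : ℕ) => τ k ω := measurable_pi_lambda _ hτ.measurable
  have mX : Measurable fun ω (m : ℕ) => X m ω := measurable_pi_lambda _ hX
  let s : Set ((ℕ → ℕ) × (ℕ → Fin N)) :=
    {p | ∀ i ≤ k, p.2 (∑ m ∈ Finset.range (i + 1), p.1 m) = y i}
  have hs : MeasurableSet s := by
    have : s = ⋂ i ≤ k, (fun p : (ℕ → ℕ) × (ℕ → Fin N) =>
        p.2 (∑ m ∈ Finset.range (i + 1), p.1 m)) ⁻¹' {y i} := by ext; simp [s]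
    rw [this]
    exact MeasurableSet.iInter fun i => MeasurableSet.iInter fun _ =>
      measurable_eval_at (measurable_partialSum i) (measurableSet_singleton _)
  have h1 : {ω | ∀ i ≤ k, observed X τ i ω = y i}
      = (fun ω => ((fun k => τ k ω), (fun m => X m ω))) ⁻¹' s := rfl
  -- Independence of times and chain makes the joint law a product, and Tonelli's theorem then
  -- freezes the times.
  have hlaw := (indepFun_iff_map_prod_eq_prod_map_map mτ.aemeasurable mX.aemeasurable).1
    hτ.indep_chain
  have : IsProbabilityMeasure (Pr.map fun ω m => X m ω) :=
    Measure.isProbabilityMeasure_map mX.aemeasurable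
  have hm : Measurable fun t : ℕ → ℕ => (Pr.map fun ω m => X m ω) (Prod.mk t ⁻¹' s) :=
    measurable_measure_prodMk_left hs
  have hm' : Measurable fun ω => (Pr.map fun ω m => X m ω) ((Prod.mk fun k => τ k ω) ⁻¹' s) :=
    hm.comp mτ
  rw [measureReal_def, h1, ← Measure.map_apply (mτ.prodMk mX) hs, hlaw, Measure.prod_apply hs,
    lintegral_map hm mτ, ← integral_toReal hm'.aemeasurable
      (Eventually.of_forall fun ω => measure_lt_top _ _)]
  congr 1 with ω
  rw [Measure.map_apply mX (measurable_prodMk_left hs)]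
  rfl

/-- The observed sequence is a Markov chain with transition matrix `∑ μ(l) P ^ l`. -/
theorem isMarkovChain_observed (hP : P ∈ Matrix.rowStochastic ℝ (Fin N))
    (hX : IsMarkovChain Pr P X) (hτ : IsSamplingScheme Pr μ X τ) :
    IsMarkovChain Pr (genMatrix μ P) (observed X τ) where
  measurable := measurable_observed hX.measurable hτ.measurable
  markov k y := by
    rw [measureReal_observed_path hX.measurable hτ, measureReal_observed_path hX.measurable hτ]
    -- The path probability as a function of the first `k + 1` gaps only; the zero padding is never
    -- read. Its domain is countable, so measurability is free, and it is independent of the next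
    -- gap.
    let g : (Finset.range (k + 1) → ℕ) → ℝ := fun t =>
      Pr.real {ω' | ∀ i ≤ k, X (∑ m ∈ Finset.range (i + 1),
        if h : m ∈ Finset.range (k + 1) then t ⟨m, h⟩ else 0) ω' = y i}
    let q : ℕ → ℝ := fun l => (P ^ l) (y k) (y (k + 1))
    have hg : ∀ ω, Pr.real {ω' | ∀ i ≤ k, X (obsTime τ i ω) ω' = y i}
        = g fun i => τ i ω := by
      intro ω
      simp only [g, obsTime]
      congr 1
      ext ω'
      refine forall₂_congr fun i hi => ?_
      have : ∑ m ∈ Finset.range (i + 1), τ m ω = ∑ m ∈ Finset.range (i + 1),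
          if m ∈ Finset.range (k + 1) then τ m ω else 0 := by
        refine Finset.sum_congr rfl fun m hm => ?_
        rw [if_pos]
        exact Finset.mem_range.2 (by have := Finset.mem_range.1 hm; omega)
      rw [this]
      simp
    have hstep : ∀ ω, Pr.real {ω' | ∀ i ≤ k + 1, X (obsTime τ i ω) ω' = y i}
        = g (fun i => τ i ω) * q (τ (k + 1) ω) := by
      intro ω
      have hmono : Monotone fun i => obsTime τ i ω := monotone_nat_of_le_succ fun i => by
        simp only [obsTime]
        rw [Finset.sum_range_succ _ (i + 1)]
        exact Nat.le_add_right _ _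
      rw [measureReal_path_at_times hX (fun i => obsTime τ i ω) hmono, hg]
      simp only [q]
      congr 3
      simp only [obsTime]
      rw [Finset.sum_range_succ _ (k + 1), Nat.add_sub_cancel_left]
    simp_rw [hstep, hg]
    have hind : IndepFun (fun ω => g fun i => τ i ω) (fun ω => q (τ (k + 1) ω)) Pr := by
      have h0 := hτ.iIndep.indepFun_finset (Finset.range (k + 1)) {k + 1}
        (by simp) hτ.measurable
      exact h0.comp (φ := g) (ψ := fun t => q (t ⟨k + 1, by simp⟩)) (measurable_of_countable _)
        (measurable_of_countable _)
    have mτ' : Measurable fun ω (i : Finset.range (k + 1)) => τ i ω :=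
      measurable_pi_lambda _ fun i => hτ.measurable _
    rw [hind.integral_fun_mul_eq_mul_integral
      ((measurable_of_countable g).comp mτ').aestronglyMeasurable
      ((measurable_of_countable q).comp (hτ.measurable _)).aestronglyMeasurable]
    congr 1
    have mq : Measurable q := measurable_of_countable q
    -- Boundedness gives integrability, so that the mean of `q` over the gap can be written as the
    -- series defining `Q`.
    have hq1 : ∀ l, |q l| ≤ 1 := fun l => abs_le.2
      ⟨by linarith [Matrix.nonneg_of_mem_rowStochastic (pow_mem hP l) (i := y k) (j := y (k + 1))],
        Matrix.le_one_of_mem_rowStochastic (pow_mem hP l)⟩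
    have : IsProbabilityMeasure (Pr.map (τ (k + 1))) :=
      Measure.isProbabilityMeasure_map (hτ.measurable _).aemeasurable
    rw [← integral_map (f := q) (hτ.measurable _).aemeasurable mq.aestronglyMeasurable,
      integral_countable (Integrable.of_bound mq.aestronglyMeasurable 1
        (Eventually.of_forall hq1))]
    change _ = ∑' l : ℕ, _
    refine tsum_congr fun l => ?_
    rw [map_measureReal_apply (hτ.measurable _) (measurableSet_singleton l), measureReal_def,
      smul_eq_mul, ← hτ.law (k + 1) (by omega) l]
    rfl

end Observed


/-! ### Law of large numbers and central limit theorem for transition sums -/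

section AdditiveFunctionals

variable {N : ℕ} {Ω : Type*} [MeasurableSpace Ω] {Pr : Measure Ω} [IsProbabilityMeasure Pr]
  {Q : Matrix (Fin N) (Fin N) ℝ} {π : Fin N → ℝ} {Y : ℕ → Ω → Fin N}

/-- The sum of `f` over the first `k` transitions of a path. -/
def pathSum {N : ℕ} (f : Fin N → Fin N → ℝ) (k : ℕ) (x : ℕ → Fin N) : ℝ :=
  ∑ m ∈ Finset.range k, f (x m) (x (m + 1))

lemma pathSum_succ (f : Fin N → Fin N → ℝ) (k : ℕ) (x : ℕ → Fin N) :
    pathSum f (k + 1) x = pathSum f k x + f (x k) (x (k + 1)) :=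
  Finset.sum_range_succ _ _

lemma dependsOn_pathSum (f : Fin N → Fin N → ℝ) (k : ℕ) :
    DependsOn (pathSum f k) (Set.Iic k) := by
  intro x y hxy
  refine Finset.sum_congr rfl fun m hm => ?_
  have := Finset.mem_range.1 hm
  rw [hxy m (Set.mem_Iic.2 (by omega)), hxy (m + 1) (Set.mem_Iic.2 (by omega))]

lemma dependsOn_comp_state {β γ : Type*} {k : ℕ} {G : (ℕ → Fin N) → β}
    (hG : DependsOn G (Set.Iic k)) (φ : β → Fin N → γ) :
    DependsOn (fun x => φ (G x) (x k)) (Set.Iic k) := fun x y hxy => by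
  simp only
  rw [hG hxy, hxy k (Set.mem_Iic.2 le_rfl)]

lemma exists_abs_le_const {α : Type*} [Finite α] (f : α → ℝ) : ∃ C, 0 ≤ C ∧ ∀ a, |f a| ≤ C := by
  obtain ⟨C, hC⟩ := (Set.finite_range fun a => |f a|).bddAbove
  exact ⟨max C 0, le_max_right _ _, fun a => le_max_of_le_left (hC ⟨a, rfl⟩)⟩

/-- Martingale differences are orthogonal: the cross term dies by `hf`, and each step adds at most
`C ^ 2`. -/
lemma integral_pathSum_sq_le (hQ : Q ∈ Matrix.rowStochastic ℝ (Fin N))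
    (hY : IsMarkovChain Pr Q Y) {f : Fin N → Fin N → ℝ} (hf : ∀ i, ∑ j, Q i j * f i j = 0)
    {C : ℝ} (hC : ∀ i j, |f i j| ≤ C) (k : ℕ) :
    ∫ ω, pathSum f k (fun m => Y m ω) ^ 2 ∂Pr ≤ k * C ^ 2 := by
  induction k with
  | zero => simp [pathSum]
  | succ k ih =>
    have h := integral_markov_step hY (k := k)
      (H := fun x j => (pathSum f k x + f (x k) j) ^ 2) fun j =>
        dependsOn_comp_state (dependsOn_pathSum f k) fun a i => (a + f i j) ^ 2
    have h2 : ∀ ω, ∑ j, Q (Y k ω) j • (pathSum f k (fun m => Y m ω) + f (Y k ω) j) ^ 2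
        ≤ pathSum f k (fun m => Y m ω) ^ 2 + C ^ 2 := by
      intro ω
      set a := pathSum f k fun m => Y m ω
      set i := Y k ω
      have e : ∑ j, Q i j • (a + f i j) ^ 2 = a ^ 2 + ∑ j, Q i j * f i j ^ 2 := by
        have : ∑ j, Q i j • (a + f i j) ^ 2 = a ^ 2 * ∑ j, Q i j + 2 * a * ∑ j, Q i j * f i j
            + ∑ j, Q i j * f i j ^ 2 := by
          simp only [Finset.mul_sum, ← Finset.sum_add_distrib, smul_eq_mul]
          exact Finset.sum_congr rfl fun j _ => by ring
        rw [this, hf, Matrix.sum_row_of_mem_rowStochastic hQ]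
        ring
      rw [e]
      gcongr
      calc ∑ j, Q i j * f i j ^ 2 ≤ ∑ j, Q i j * C ^ 2 := by
            refine Finset.sum_le_sum fun j _ => mul_le_mul_of_nonneg_left ?_
              (Matrix.nonneg_of_mem_rowStochastic hQ)
            exact sq_le_sq.2 ((hC i j).trans (le_abs_self C))
        _ = C ^ 2 := by rw [← Finset.sum_mul, Matrix.sum_row_of_mem_rowStochastic hQ, one_mul]
    have hint : Integrable (fun ω => pathSum f k (fun m => Y m ω) ^ 2) Pr :=
      integrable_of_dependsOn hY.measurable (G := fun x => pathSum f k x ^ 2)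
        fun x y hxy => by simp only; rw [dependsOn_pathSum f k hxy]
    calc ∫ ω, pathSum f (k + 1) (fun m => Y m ω) ^ 2 ∂Pr
        = ∫ ω, ∑ j, Q (Y k ω) j • (pathSum f k (fun m => Y m ω) + f (Y k ω) j) ^ 2 ∂Pr := by
          simp_rw [pathSum_succ]; exact h
      _ ≤ ∫ ω, (pathSum f k (fun m => Y m ω) ^ 2 + C ^ 2) ∂Pr := by
          refine integral_mono ?_ (hint.add (integrable_const _)) h2
          exact integrable_of_dependsOn hY.measurable
            (G := fun x => ∑ j, Q (x k) j • (pathSum f k x + f (x k) j) ^ 2)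
            (dependsOn_comp_state (dependsOn_pathSum f k)
              fun a i => ∑ j, Q i j • (a + f i j) ^ 2)
      _ ≤ _ := by
          rw [integral_add hint (integrable_const _)]
          simp only [integral_const, probReal_univ, one_smul]
          push_cast
          linarith

/-- Weak law of large numbers for the transitions of an ergodic chain. -/
theorem tendstoInMeasure_transition_average (hQ : Q ∈ Matrix.rowStochastic ℝ (Fin N))
    {K : ℕ} (hK : ∀ i j, 0 < (Q ^ K) i j)
    (hπ : π ∈ stdSimplex ℝ (Fin N)) (hπQ : Matrix.vecMul π Q = π)
    (hY : IsMarkovChain Pr Q Y) (F : Fin N → Fin N → ℝ) :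
    TendstoInMeasure Pr (fun (n : ℕ) ω => pathSum F (n - 1) (fun m => Y m ω) / n) atTop
      (fun _ => ∑ i, π i * ∑ j, Q i j * F i j) := by
  set c := ∑ i, π i * ∑ j, Q i j * F i j with hc
  obtain ⟨h, hh⟩ := exists_poisson hQ hK hπ hπQ (g := fun i => ∑ j, Q i j * F i j - c) (by
    simp only [dotProduct, mul_sub, Finset.sum_sub_distrib, ← Finset.sum_mul, hπ.2, hc]
    ring)
  -- Martingale part of `F - c`; the Poisson solution `h` accounts for the rest by telescoping
  -- (`htel`).
  let f : Fin N → Fin N → ℝ := fun i j => F i j - c + h j - h i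
  have hf : ∀ i, ∑ j, Q i j * f i j = 0 := by
    intro i
    have : ∑ j, Q i j * f i j
        = ∑ j, Q i j * F i j + ∑ j, Q i j * h j - (c + h i) * ∑ j, Q i j := by
      simp only [Finset.mul_sum, ← Finset.sum_add_distrib, ← Finset.sum_sub_distrib]
      exact Finset.sum_congr rfl fun j _ => by simp only [f]; ring
    rw [this, Matrix.sum_row_of_mem_rowStochastic hQ]
    linarith [hh i]
  obtain ⟨C, -, hC⟩ := exists_abs_le_const fun p : Fin N × Fin N => f p.1 p.2
  obtain ⟨D, hD0, hD⟩ := exists_abs_le_const h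
  have htel : ∀ (k : ℕ) (x : ℕ → Fin N),
      pathSum F k x - k * c = pathSum f k x + h (x 0) - h (x k) := by
    intro k x
    induction k with
    | zero => simp [pathSum]
    | succ k ih =>
      rw [pathSum_succ, pathSum_succ]
      simp only [f] at ih ⊢
      push_cast
      linarith
  -- `2 * D` bounds the telescoped boundary terms; `|c|` pays for dividing `n - 1` transitions by
  -- `n`.
  set B := 2 * D + |c|
  have hB : 0 ≤ B := by positivity
  have hpt : ∀ n : ℕ, 0 < n → ∀ ω, (n * (pathSum F (n - 1) (fun m => Y m ω) / n - c)) ^ 2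
      ≤ 2 * pathSum f (n - 1) (fun m => Y m ω) ^ 2 + 2 * B ^ 2 := by
    intro n hn ω
    have hn' : (n : ℝ) ≠ 0 := by positivity
    have h1 := htel (n - 1) fun m => Y m ω
    rw [Nat.cast_sub hn, Nat.cast_one] at h1
    set a := pathSum f (n - 1) fun m => Y m ω
    set b := h (Y 0 ω) - h (Y (n - 1) ω) - c with hb
    have e : n * (pathSum F (n - 1) (fun m => Y m ω) / n - c) = a + b := by
      rw [mul_sub, mul_div_cancel₀ _ hn', hb]
      linarith
    have hbB : |b| ≤ B := by
      have h2 := abs_le.1 (hD (Y 0 ω))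
      have h3 := abs_le.1 (hD (Y (n - 1) ω))
      have h4 := neg_abs_le c
      have h5 := le_abs_self c
      rw [abs_le]
      constructor <;> simp only [hb, B] <;> linarith
    rw [e]
    have hb2 : b ^ 2 ≤ B ^ 2 := sq_le_sq.2 (hbB.trans (le_abs_self B))
    nlinarith [sq_nonneg (a - b)]
  rw [tendstoInMeasure_iff_measureReal_norm]
  intro ε hε
  have hlim : Tendsto (fun n : ℕ => ((2 * C ^ 2 + 2 * B ^ 2) / ε ^ 2) / (n : ℝ)) atTop (𝓝 0) :=
    tendsto_const_div_atTop_nhds_zero_nat _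
  refine squeeze_zero' (Eventually.of_forall fun n => measureReal_nonneg) ?_ hlim
  filter_upwards [eventually_gt_atTop 0] with n hn
  have hn' : (0 : ℝ) < n := by exact_mod_cast hn
  have hn1 : (1 : ℝ) ≤ n := by exact_mod_cast hn
  have hintf : Integrable (fun ω => pathSum f (n - 1) (fun m => Y m ω) ^ 2) Pr :=
    integrable_of_dependsOn hY.measurable (G := fun x => pathSum f (n - 1) x ^ 2)
      fun x y hxy => by simp only; rw [dependsOn_pathSum f (n - 1) hxy]
  have hintF : Integrable
      (fun ω => (n * (pathSum F (n - 1) (fun m => Y m ω) / n - c)) ^ 2) Pr :=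
    integrable_of_dependsOn hY.measurable
      (G := fun x => (n * (pathSum F (n - 1) x / n - c)) ^ 2)
      fun x y hxy => by simp only; rw [dependsOn_pathSum F (n - 1) hxy]
  -- Chebyshev's inequality: the second moment is of order `n`, against the threshold `(n * ε) ^ 2`.
  have hmark := mul_meas_ge_le_integral_of_nonneg (μ := Pr)
    (Eventually.of_forall fun ω => sq_nonneg _) hintF ((n * ε) ^ 2)
  have hset : {ω | ε ≤ ‖pathSum F (n - 1) (fun m => Y m ω) / n - c‖}
      = {ω | (n * ε) ^ 2 ≤ (n * (pathSum F (n - 1) (fun m => Y m ω) / n - c)) ^ 2} := by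
    ext ω
    simp only [Set.mem_ofPred_eq, Real.norm_eq_abs]
    rw [sq_le_sq, abs_mul, abs_mul, abs_of_pos hε, abs_of_pos hn']
    exact (mul_le_mul_iff_right₀ hn').symm
  have hbound : ∫ ω, (n * (pathSum F (n - 1) (fun m => Y m ω) / n - c)) ^ 2 ∂Pr
      ≤ n * (2 * C ^ 2 + 2 * B ^ 2) := by
    calc _ ≤ ∫ ω, (2 * pathSum f (n - 1) (fun m => Y m ω) ^ 2 + 2 * B ^ 2) ∂Pr :=
          integral_mono hintF ((hintf.const_mul 2).add (integrable_const _)) (hpt n hn)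
      _ = 2 * ∫ ω, pathSum f (n - 1) (fun m => Y m ω) ^ 2 ∂Pr + 2 * B ^ 2 := by
          rw [integral_add (hintf.const_mul 2) (integrable_const _), integral_const_mul]
          simp
      _ ≤ 2 * (n * C ^ 2) + n * (2 * B ^ 2) := by
          have h1 := integral_pathSum_sq_le hQ hY hf (fun i j => hC (i, j)) (n - 1)
          rw [Nat.cast_sub hn, Nat.cast_one] at h1
          nlinarith [sq_nonneg C, sq_nonneg B]
      _ = _ := by ring
  rw [hset, div_div, le_div_iff₀ (by positivity)]
  have h6 := hmark.trans hbound
  rw [measureReal_def] at *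
  have h7 : (n : ℝ) * (((Pr {ω | (n * ε) ^ 2 ≤
      (n * (pathSum F (n - 1) (fun m => Y m ω) / n - c)) ^ 2}).toReal) * (ε ^ 2 * n))
      ≤ n * (2 * C ^ 2 + 2 * B ^ 2) := by
    refine le_trans (le_of_eq ?_) h6
    ring
  exact le_of_mul_le_mul_left h7 hn'

lemma isBigO_exp_taylor_two (a : ℝ) :
    (fun s : ℝ => Complex.exp ((s * a : ℝ) * Complex.I)
      - (1 + (s * a : ℝ) * Complex.I - ((s * a) ^ 2 / 2 : ℝ))) =O[𝓝 0] fun s : ℝ => s ^ 3 := by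
  refine Asymptotics.IsBigO.of_bound (|a| ^ 3 * Real.exp |a|) ?_
  filter_upwards [Metric.closedBall_mem_nhds (0 : ℝ) one_pos] with s hs
  have hs1 : |s| ≤ 1 := by simpa using hs
  have h := Complex.norm_exp_sub_sum_le_norm_mul_exp ((s * a : ℝ) * Complex.I) 3
  have e : ∑ m ∈ Finset.range 3, ((s * a : ℝ) * Complex.I) ^ m / (m.factorial : ℂ)
      = 1 + (s * a : ℝ) * Complex.I - ((s * a) ^ 2 / 2 : ℝ) := by
    simp only [Finset.sum_range_succ, Finset.sum_range_zero, Nat.factorial, mul_pow, Complex.I_sq]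
    push_cast
    ring
  rw [e] at h
  refine h.trans ?_
  have en : ‖((s * a : ℝ) : ℂ) * Complex.I‖ = |s| * |a| := by
    rw [norm_mul, Complex.norm_I, mul_one, Complex.norm_real, Real.norm_eq_abs, abs_mul]
  rw [en, norm_pow, Real.norm_eq_abs, mul_pow]
  have : Real.exp (|s| * |a|) ≤ Real.exp |a| :=
    Real.exp_le_exp.2 (mul_le_of_le_one_left (abs_nonneg _) hs1)
  calc |s| ^ 3 * |a| ^ 3 * Real.exp (|s| * |a|) ≤ |s| ^ 3 * |a| ^ 3 * Real.exp |a| := by gcongr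
    _ = _ := by ring

/-- Third-order accuracy of the corrected characteristic recursion, where `h` solves the Poisson
equation of the conditional variances. -/
lemma isBigO_charFun_step (hQ : Q ∈ Matrix.rowStochastic ℝ (Fin N))
    {f : Fin N → Fin N → ℝ} (hf : ∀ i, ∑ j, Q i j * f i j = 0) {v : ℝ} {h : Fin N → ℝ}
    (hh : ∀ i, h i - ∑ j, Q i j * h j = ∑ j, Q i j * f i j ^ 2 - v) (i : Fin N) :
    (fun s : ℝ => ∑ j, (Q i j : ℂ) * (Complex.exp ((s * f i j : ℝ) * Complex.I)
        * (1 - (s ^ 2 / 2 * h j : ℝ)))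
      - (1 - (s ^ 2 * v / 2 : ℝ)) * (1 - (s ^ 2 / 2 * h i : ℝ))) =O[𝓝 0] fun s : ℝ => s ^ 3 := by
  have hid : ∀ s : ℝ, ∑ j, (Q i j : ℂ) * (Complex.exp ((s * f i j : ℝ) * Complex.I)
        * (1 - (s ^ 2 / 2 * h j : ℝ)))
      - (1 - (s ^ 2 * v / 2 : ℝ)) * (1 - (s ^ 2 / 2 * h i : ℝ))
      = ∑ j, (Q i j : ℂ) * ((Complex.exp ((s * f i j : ℝ) * Complex.I)
          - (1 + (s * f i j : ℝ) * Complex.I - ((s * f i j) ^ 2 / 2 : ℝ)))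
          * (1 - (s ^ 2 / 2 * h j : ℝ)))
        + (s ^ 3 : ℝ) * ((∑ j, (Q i j : ℂ) * (-(f i j * h j / 2 : ℝ) * Complex.I
          + (s * f i j ^ 2 * h j / 4 : ℝ))) - (s * v * h i / 4 : ℝ)) := by
    intro s
    have e1 : ∑ j, (Q i j : ℂ) * (Complex.exp ((s * f i j : ℝ) * Complex.I)
        * (1 - (s ^ 2 / 2 * h j : ℝ)))
        = ∑ j, (Q i j : ℂ) * ((Complex.exp ((s * f i j : ℝ) * Complex.I)
          - (1 + (s * f i j : ℝ) * Complex.I - ((s * f i j) ^ 2 / 2 : ℝ)))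
          * (1 - (s ^ 2 / 2 * h j : ℝ)))
        + (s ^ 3 : ℝ) * (∑ j, (Q i j : ℂ) * (-(f i j * h j / 2 : ℝ) * Complex.I
          + (s * f i j ^ 2 * h j / 4 : ℝ)))
        + (((∑ j, Q i j : ℝ) : ℂ) + s * Complex.I * ((∑ j, Q i j * f i j : ℝ) : ℂ)
          - s ^ 2 / 2 * ((∑ j, Q i j * f i j ^ 2 : ℝ) : ℂ)
          - s ^ 2 / 2 * ((∑ j, Q i j * h j : ℝ) : ℂ)) := by
      push_cast
      simp only [Finset.mul_sum, ← Finset.sum_add_distrib, ← Finset.sum_sub_distrib]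
      refine Finset.sum_congr rfl fun j _ => ?_
      ring
    -- The orders 0, 1 and 2 in `s` cancel by the row sums, the centring of `f` and the Poisson
    -- equation, respectively.
    rw [e1, hf, Matrix.sum_row_of_mem_rowStochastic hQ,
      show ∑ j, Q i j * h j = h i - (∑ j, Q i j * f i j ^ 2 - v) by linarith [hh i]]
    push_cast
    ring
  simp_rw [hid]
  refine Asymptotics.IsBigO.add (Asymptotics.IsBigO.fun_sum fun j _ => ?_) ?_
  · refine Asymptotics.IsBigO.const_mul_left ?_ _
    have hb : (fun s : ℝ => (1 - ((s ^ 2 / 2 * h j : ℝ) : ℂ))) =O[𝓝 0] fun _ => (1 : ℝ) :=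
      (Continuous.continuousAt (by fun_prop)).norm.isBoundedUnder_le.isBigO_one ℝ
    simpa using (isBigO_exp_taylor_two (f i j)).mul hb
  · have hb : (fun s : ℝ => (∑ j, (Q i j : ℂ) * (-(f i j * h j / 2 : ℝ) * Complex.I
          + (s * f i j ^ 2 * h j / 4 : ℝ))) - (s * v * h i / 4 : ℝ)) =O[𝓝 0] fun _ => (1 : ℝ) :=
      (Continuous.continuousAt (by fun_prop)).norm.isBoundedUnder_le.isBigO_one ℝ
    have hc : (fun s : ℝ => ((s ^ 3 : ℝ) : ℂ)) =O[𝓝 0] fun s : ℝ => s ^ 3 :=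
      Asymptotics.IsBigO.of_bound 1 (Eventually.of_forall fun s => by
        rw [Complex.norm_real, one_mul])
    simpa using hc.mul hb

lemma norm_exp_ofReal_mul_I_le (x : ℝ) : ‖Complex.exp ((x : ℂ) * Complex.I)‖ ≤ 1 :=
  (Complex.norm_exp_ofReal_mul_I x).le

/-- Central limit theorem for martingale differences along an ergodic chain, in terms of
characteristic functions. -/
theorem tendsto_charFun_pathSum (hQ : Q ∈ Matrix.rowStochastic ℝ (Fin N))
    {K : ℕ} (hK : ∀ i j, 0 < (Q ^ K) i j)
    (hπ : π ∈ stdSimplex ℝ (Fin N)) (hπQ : Matrix.vecMul π Q = π)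
    (hY : IsMarkovChain Pr Q Y) {f : Fin N → Fin N → ℝ} (hf : ∀ i, ∑ j, Q i j * f i j = 0) :
    Tendsto (fun n : ℕ => ∫ ω, Complex.exp
        (((√n)⁻¹ * pathSum f (n - 1) (fun m => Y m ω) : ℝ) * Complex.I) ∂Pr) atTop
      (𝓝 (Complex.exp (-((∑ i, π i * ∑ j, Q i j * f i j ^ 2 : ℝ) : ℂ) / 2))) := by
  set v := ∑ i, π i * ∑ j, Q i j * f i j ^ 2 with hv
  have hv0 : 0 ≤ v := Finset.sum_nonneg fun i _ => mul_nonneg (hπ.1 i)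
    (Finset.sum_nonneg fun j _ => mul_nonneg (Matrix.nonneg_of_mem_rowStochastic hQ)
      (sq_nonneg _))
  obtain ⟨h, hh⟩ := exists_poisson hQ hK hπ hπQ (g := fun i => ∑ j, Q i j * f i j ^ 2 - v) (by
    simp only [dotProduct, mul_sub, Finset.sum_sub_distrib, ← Finset.sum_mul, hπ.2, hv]
    ring)
  obtain ⟨D, hD0, hD⟩ := exists_abs_le_const h
  choose C hC using fun i => (isBigO_charFun_step hQ hf hh i).bound
  let R : ℝ → ℂ := fun s => 1 - (s ^ 2 * v / 2 : ℝ)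
  let A : ℝ → ℕ → Ω → ℂ := fun s k ω =>
    Complex.exp ((s * pathSum f k (fun m => Y m ω) : ℝ) * Complex.I)
  -- The corrector `w` compensates the dependence of the conditional variance on the current state.
  -- With it, one step multiplies `u s k` by `R s` up to an error of order `|s| ^ 3`.
  let w : ℝ → Fin N → ℂ := fun s i => 1 - (s ^ 2 / 2 * h i : ℝ)
  let u : ℝ → ℕ → ℂ := fun s k => ∫ ω, A s k ω * w s (Y k ω) ∂Pr
  set C' := ∑ i, |C i|
  have hintA : ∀ s k, Integrable (A s k) Pr := fun s k =>
    integrable_of_dependsOn hY.measurable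
      (G := fun x => Complex.exp ((s * pathSum f k x : ℝ) * Complex.I))
      fun x y hxy => by simp only; rw [dependsOn_pathSum f k hxy]
  have hintAg : ∀ s k (g : Fin N → ℂ), Integrable (fun ω => A s k ω * g (Y k ω)) Pr :=
    fun s k g => integrable_of_dependsOn hY.measurable
      (G := fun x => Complex.exp ((s * pathSum f k x : ℝ) * Complex.I) * g (x k))
      (dependsOn_comp_state (dependsOn_pathSum f k)
        fun a i => Complex.exp ((s * a : ℝ) * Complex.I) * g i)
  have hAnorm : ∀ s k ω, ‖A s k ω‖ ≤ 1 := fun s k ω => norm_exp_ofReal_mul_I_le _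
  have hstep : ∀ᶠ s : ℝ in 𝓝 0, ∀ k, ‖u s (k + 1) - R s * u s k‖ ≤ C' * |s| ^ 3 := by
    filter_upwards [eventually_all.2 hC] with s hs k
    have h1 := integral_markov_step hY (k := k)
      (H := fun x j => Complex.exp ((s * (pathSum f k x + f (x k) j) : ℝ) * Complex.I) * w s j)
      fun j => dependsOn_comp_state (dependsOn_pathSum f k)
        fun a i => Complex.exp ((s * (a + f i j) : ℝ) * Complex.I) * w s j
    have h2 : u s (k + 1) = ∫ ω, A s k ω * ∑ j, (Q (Y k ω) j : ℂ) *
        (Complex.exp ((s * f (Y k ω) j : ℝ) * Complex.I) * w s j) ∂Pr := by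
      simp only [u, A, pathSum_succ]
      rw [h1]
      congr 1 with ω
      rw [Finset.mul_sum]
      refine Finset.sum_congr rfl fun j _ => ?_
      rw [Complex.real_smul, mul_add, Complex.ofReal_add, add_mul, Complex.exp_add]
      ring
    have h3 : u s (k + 1) - R s * u s k = ∫ ω, A s k ω * ((∑ j, (Q (Y k ω) j : ℂ) *
        (Complex.exp ((s * f (Y k ω) j : ℝ) * Complex.I) * w s j)) - R s * w s (Y k ω)) ∂Pr := by
      rw [h2, ← integral_const_mul, ← integral_sub
        (hintAg s k fun i => ∑ j, (Q i j : ℂ) *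
          (Complex.exp ((s * f i j : ℝ) * Complex.I) * w s j))
        ((hintAg s k (w s)).const_mul _)]
      congr 1 with ω
      ring
    rw [h3]
    have h4 := norm_integral_le_of_norm_le_const (μ := Pr) (C := C' * |s| ^ 3)
      (f := fun ω => A s k ω * ((∑ j, (Q (Y k ω) j : ℂ) *
        (Complex.exp ((s * f (Y k ω) j : ℝ) * Complex.I) * w s j)) - R s * w s (Y k ω)))
      (Eventually.of_forall fun ω => by
        rw [norm_mul]
        refine (mul_le_of_le_one_left (norm_nonneg _) (hAnorm s k ω)).trans ?_
        refine (hs (Y k ω)).trans ?_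
        rw [norm_pow, Real.norm_eq_abs]
        gcongr
        exact (le_abs_self _).trans
          (Finset.single_le_sum (f := fun i => |C i|) (fun i _ => abs_nonneg _)
            (Finset.mem_univ _)))
    simpa using h4
  have hw : ∀ s i, ‖w s i - 1‖ ≤ s ^ 2 / 2 * D := by
    intro s i
    simp only [w]
    rw [sub_sub_cancel_left, norm_neg, Complex.norm_real, Real.norm_eq_abs, abs_mul,
      abs_of_nonneg (by positivity : (0 : ℝ) ≤ s ^ 2 / 2)]
    gcongr
    exact hD i
  have hu : ∀ s k, ‖(∫ ω, A s k ω ∂Pr) - u s k‖ ≤ s ^ 2 / 2 * D := by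
    intro s k
    rw [← integral_sub (hintA s k) (hintAg s k (w s))]
    have := norm_integral_le_of_norm_le_const (μ := Pr) (C := s ^ 2 / 2 * D)
      (f := fun ω => A s k ω - A s k ω * w s (Y k ω)) (Eventually.of_forall fun ω => by
        rw [show A s k ω - A s k ω * w s (Y k ω) = -(A s k ω * (w s (Y k ω) - 1)) by ring,
          norm_neg, norm_mul]
        exact (mul_le_of_le_one_left (norm_nonneg _) (hAnorm s k ω)).trans (hw s _))
    simpa using this
  have hu0 : ∀ s, ‖u s 0 - 1‖ ≤ s ^ 2 / 2 * D := by
    intro s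
    have := hu s 0
    have e : ∫ ω, A s 0 ω ∂Pr = 1 := by simp [A, pathSum]
    rwa [e, norm_sub_rev] at this
  -- With a multiplier of norm at most one, the one-step errors merely add up.
  have hR : ∀ᶠ s : ℝ in 𝓝 0, ‖R s‖ ≤ 1 := by
    have hcont : Tendsto (fun s : ℝ => s ^ 2 * v / 2) (𝓝 0) (𝓝 0) := by
      have : Continuous fun s : ℝ => s ^ 2 * v / 2 := by fun_prop
      simpa using this.tendsto 0
    filter_upwards [hcont.eventually_le_const one_pos] with s hs
    have h0 : 0 ≤ s ^ 2 * v / 2 := by positivity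
    have e : R s = ((1 - s ^ 2 * v / 2 : ℝ) : ℂ) := by simp [R]
    rw [e, Complex.norm_real, Real.norm_eq_abs, abs_le]
    constructor <;> linarith
  -- The corrector is inserted at time `k` and removed at time `0`, at a cost of `s ^ 2 / 2 * D`
  -- each.
  have hiter : ∀ᶠ s : ℝ in 𝓝 0, ∀ k : ℕ,
      ‖(∫ ω, A s k ω ∂Pr) - R s ^ k‖ ≤ k * (C' * |s| ^ 3) + s ^ 2 * D := by
    filter_upwards [hstep, hR] with s hs hRs k
    have h1 : ∀ k : ℕ, ‖u s k - R s ^ k * u s 0‖ ≤ k * (C' * |s| ^ 3) := by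
      intro k
      induction k with
      | zero => simp
      | succ k ih =>
        have e : u s (k + 1) - R s ^ (k + 1) * u s 0
            = (u s (k + 1) - R s * u s k) + R s * (u s k - R s ^ k * u s 0) := by ring
        rw [e]
        refine (norm_add_le _ _).trans ?_
        rw [norm_mul]
        have := mul_le_of_le_one_left (norm_nonneg (u s k - R s ^ k * u s 0)) hRs
        push_cast
        linarith [hs k]
    have e : (∫ ω, A s k ω ∂Pr) - R s ^ k = ((∫ ω, A s k ω ∂Pr) - u s k)
        + (u s k - R s ^ k * u s 0) + R s ^ k * (u s 0 - 1) := by ring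
    rw [e]
    refine (norm_add₃_le).trans ?_
    have h2 : ‖R s ^ k * (u s 0 - 1)‖ ≤ s ^ 2 / 2 * D := by
      rw [norm_mul, norm_pow]
      exact (mul_le_of_le_one_left (norm_nonneg _) (pow_le_one₀ (norm_nonneg _) hRs)).trans
        (hu0 s)
    linarith [hu s k, h1 k]
  have hs0 : Tendsto (fun n : ℕ => (√(n : ℝ))⁻¹) atTop (𝓝 0) :=
    tendsto_inv_atTop_zero.comp (Real.tendsto_sqrt_atTop.comp tendsto_natCast_atTop_atTop)
  -- At `s = 1 / √n` the accumulated error of `n` steps is of order `n * n ^ (-3/2)`.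
  have hmain : Tendsto (fun n : ℕ => (∫ ω, A (√n)⁻¹ (n - 1) ω ∂Pr) - R (√n)⁻¹ ^ (n - 1))
      atTop (𝓝 0) := by
    have hb : Tendsto (fun n : ℕ => C' * (√(n : ℝ))⁻¹ + ((√(n : ℝ))⁻¹) ^ 2 * D) atTop (𝓝 0) := by
      simpa using (hs0.const_mul C').add ((hs0.pow 2).mul_const D)
    refine squeeze_zero_norm' ?_ hb
    filter_upwards [hs0.eventually hiter, eventually_gt_atTop 0] with n hn hn0
    refine (hn (n - 1)).trans ?_
    have hn0' : (0 : ℝ) < n := by exact_mod_cast hn0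
    have hsq : (√(n : ℝ))⁻¹ ^ 2 = (n : ℝ)⁻¹ := by rw [inv_pow, Real.sq_sqrt hn0'.le]
    have hC0 : 0 ≤ C' := Finset.sum_nonneg fun i _ => abs_nonneg _
    rw [abs_of_nonneg (by positivity : (0 : ℝ) ≤ (√(n : ℝ))⁻¹)]
    refine add_le_add ?_ le_rfl
    calc ((n - 1 : ℕ) : ℝ) * (C' * (√(n : ℝ))⁻¹ ^ 3) ≤ n * (C' * (√(n : ℝ))⁻¹ ^ 3) := by
          gcongr
          omega
      _ = C' * (√(n : ℝ))⁻¹ * (n * (√(n : ℝ))⁻¹ ^ 2) := by ring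
      _ = C' * (√(n : ℝ))⁻¹ := by rw [hsq, mul_inv_cancel₀ hn0'.ne', mul_one]
  have hRpow : Tendsto (fun n : ℕ => R (√n)⁻¹ ^ n) atTop (𝓝 (Complex.exp (-(v : ℂ) / 2))) := by
    have h1 := Complex.tendsto_one_add_div_pow_exp (-(v : ℂ) / 2)
    refine h1.congr' ?_
    filter_upwards [eventually_gt_atTop 0] with n hn0
    have hn0' : (0 : ℝ) < n := by exact_mod_cast hn0
    congr 1
    simp only [R]
    rw [inv_pow, Real.sq_sqrt hn0'.le]
    push_cast
    ring
  have hR1 : Tendsto (fun n : ℕ => R (√(n : ℝ))⁻¹) atTop (𝓝 1) := by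
    have hc : Continuous R := by fun_prop
    have h1 := (hc.tendsto 0).comp hs0
    rwa [show R 0 = 1 by simp [R]] at h1
  -- A sample of size `n` has `n - 1` transitions; the missing factor tends to one.
  have hRpow' : Tendsto (fun n : ℕ => R (√n)⁻¹ ^ (n - 1)) atTop
      (𝓝 (Complex.exp (-(v : ℂ) / 2))) := by
    have h1 := hRpow.div hR1 one_ne_zero
    rw [div_one] at h1
    refine h1.congr' ?_
    filter_upwards [hR1.eventually_ne one_ne_zero, eventually_gt_atTop 0] with n hn hn0
    simp only [Pi.div_apply]
    rw [div_eq_iff hn, ← pow_succ, Nat.sub_add_cancel hn0]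
  have hlim := hmain.add hRpow'
  simp only [sub_add_cancel, zero_add] at hlim
  exact hlim

end AdditiveFunctionals


/-! ### Commutators, the Gram matrix and the error identity -/

section LinearAlgebra

variable {N r : ℕ} {S : Set (Fin N × Fin N)} {P P₀ Q : Matrix (Fin N) (Fin N) ℝ}

lemma Delta_mulVec_vec (A M : Matrix (Fin N) (Fin N) ℝ) :
    (Delta A).mulVec (Matrix.vec M) = Matrix.vec (A * M - M * A) := by
  rw [Delta, Matrix.sub_mulVec, Matrix.kronecker_mulVec_vec, Matrix.kronecker_mulVec_vec,
    Matrix.vec_sub]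
  simp

lemma PhiMat_mulVec (φ : Module.Basis (Fin r) ℝ (linSpace S)) (c : Fin r → ℝ) :
    (PhiMat φ).mulVec c
      = Matrix.vec ((∑ j, c j • φ j : linSpace S) : Matrix (Fin N) (Fin N) ℝ) := by
  ext x
  simp only [PhiMat, Matrix.mulVec, dotProduct, Matrix.of_apply, Submodule.coe_sum,
    Submodule.coe_smul, Matrix.vec, Matrix.sum_apply, Matrix.smul_apply, smul_eq_mul]
  exact Finset.sum_congr rfl fun j _ => mul_comm _ _

lemma gram_eq (φ : Module.Basis (Fin r) ℝ (linSpace S)) (A : Matrix (Fin N) (Fin N) ℝ) :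
    gram φ A = (Delta A * PhiMat φ).transpose * (Delta A * PhiMat φ) := by
  simp only [gram, Matrix.transpose_mul, Matrix.mul_assoc]

lemma mem_affineSet_of_identifiable (hid : Identifiable S P Q) : P ∈ affineSet S :=
  ((Set.ext_iff.1 hid P).2 rfl).1

lemma commute_of_identifiable (hid : Identifiable S P Q) : Q * P = P * Q :=
  ((Set.ext_iff.1 hid P).2 rfl).2 Q rfl

lemma add_mem_affineSet {A : Matrix (Fin N) (Fin N) ℝ} (hA : A ∈ affineSet S) (D : linSpace S) :
    A + D ∈ affineSet S := by
  obtain ⟨D, hD1, hD2⟩ := D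
  refine ⟨by rw [Matrix.add_mulVec, hA.1, hD1, add_zero], fun x hx => ?_⟩
  by_contra hS
  have h1 : A x.1 x.2 = 0 := not_not.1 fun h => hS (hA.2 h)
  have h2 : D x.1 x.2 = 0 := not_not.1 fun h => hS (hD2 h)
  exact hx (by simp [h1, h2])

lemma sub_mem_linSpace {A B : Matrix (Fin N) (Fin N) ℝ} (hA : A ∈ affineSet S)
    (hB : B ∈ affineSet S) : A - B ∈ linSpace S := by
  refine ⟨by rw [Matrix.sub_mulVec, hA.1, hB.1, sub_self], fun x hx => ?_⟩
  by_contra hS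
  have h1 : A x.1 x.2 = 0 := not_not.1 fun h => hS (hA.2 h)
  have h2 : B x.1 x.2 = 0 := not_not.1 fun h => hS (hB.2 h)
  exact hx (by simp [h1, h2])

/-- Identifiability makes the Gram matrix at the true transition matrix invertible. -/
lemma isUnit_gram (hid : Identifiable S P Q) (φ : Module.Basis (Fin r) ℝ (linSpace S)) :
    IsUnit (gram φ Q) := by
  rw [← Matrix.mulVec_injective_iff_isUnit]
  refine (injective_iff_map_eq_zero (Matrix.mulVecLin (gram φ Q))).2 fun c hc => ?_
  -- Over the reals `Mᵀ M c = 0` forces `M c = 0`, so the element of `linSpace S` with coordinates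
  -- `c` commutes with `Q`.
  rw [Matrix.mulVecLin_apply, gram_eq, ← Matrix.conjTranspose_eq_transpose_of_trivial,
    Matrix.conjTranspose_mul_self_mulVec_eq_zero, ← Matrix.mulVec_mulVec, PhiMat_mulVec,
    Delta_mulVec_vec, Matrix.vec_eq_zero_iff, sub_eq_zero] at hc
  set D : linSpace S := ∑ j, c j • φ j with hD
  have hmem : P + (D : Matrix (Fin N) (Fin N) ℝ) ∈ affineSet S ∩ Set.centralizer {Q} := by
    refine ⟨add_mem_affineSet (mem_affineSet_of_identifiable hid) D, ?_⟩
    rintro _ rfl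
    rw [mul_add, add_mul, commute_of_identifiable hid, hc]
  rw [show affineSet S ∩ Set.centralizer {Q} = {P} from hid] at hmem
  have hD0 : D = 0 := Subtype.ext (by simpa using hmem)
  have := φ.repr_sum_self c
  rw [← hD, hD0] at this
  simpa using this.symm

/-- The estimation error is a linear image of the error of the transition matrix. -/
lemma estimator_sub (φ : Module.Basis (Fin r) ℝ (linSpace S)) (hP : P ∈ affineSet S)
    (hP₀ : P₀ ∈ affineSet S) (hcomm : Q * P = P * Q) {A : Matrix (Fin N) (Fin N) ℝ}
    (hA : IsUnit (gram φ A)) :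
    estimator φ P₀ A - WithLp.toLp 2 (Matrix.vec P)
      = WithLp.toLp 2 ((BMat φ P A).mulVec (Matrix.vec (A - Q))) := by
  have hdet : IsUnit (gram φ A).det := (Matrix.isUnit_iff_isUnit_det _).1 hA
  set G := PhiMat φ * (gram φ A)⁻¹ * (PhiMat φ).transpose * (Delta A).transpose with hG
  -- Hence `1 - G * Delta A` kills the range of `Φ`, which contains `vec (P₀ - P)`; the base point
  -- may be replaced by `P`.
  have hGΦ : G * Delta A * PhiMat φ = PhiMat φ := by
    have : G * Delta A * PhiMat φ = PhiMat φ * ((gram φ A)⁻¹ * gram φ A) := by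
      simp only [hG, gram, Matrix.mul_assoc]
    rw [this, Matrix.nonsing_inv_mul _ hdet, Matrix.mul_one]
  obtain ⟨c, hc⟩ : ∃ c, (PhiMat φ).mulVec c = Matrix.vec (P₀ - P) := by
    refine ⟨φ.repr ⟨P₀ - P, sub_mem_linSpace hP₀ hP⟩, ?_⟩
    rw [PhiMat_mulVec, φ.sum_repr]
  have h1 : (1 - G * Delta A).mulVec (Matrix.vec P₀)
      = Matrix.vec P - (G * Delta A).mulVec (Matrix.vec P) := by
    have e : Matrix.vec P₀ = Matrix.vec P + (PhiMat φ).mulVec c := by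
      rw [hc, Matrix.vec_sub]; abel
    rw [e, Matrix.mulVec_add, Matrix.mulVec_mulVec, Matrix.sub_mul, hGΦ, Matrix.one_mul, sub_self,
      Matrix.zero_mulVec, add_zero, Matrix.sub_mulVec, Matrix.one_mulVec]
  -- Since `Q` and `P` commute, the commutator of `A` with `P` equals that of `A - Q` with `P`;
  -- exchanging its arguments gives the sign.
  have h2 : (Delta A).mulVec (Matrix.vec P) = -(Delta P).mulVec (Matrix.vec (A - Q)) := by
    rw [Delta_mulVec_vec, Delta_mulVec_vec, ← Matrix.vec_neg]
    congr 1
    rw [mul_sub, sub_mul, hcomm]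
    abel
  rw [estimator, ← WithLp.toLp_sub]
  congr 1
  rw [h1, ← Matrix.mulVec_mulVec, h2, Matrix.mulVec_neg, Matrix.mulVec_mulVec]
  simp only [BMat, hG]
  abel

lemma continuous_Delta : Continuous (Delta : Matrix (Fin N) (Fin N) ℝ → _) := by
  refine continuous_matrix fun x y => ?_
  simp only [Delta, Matrix.sub_apply, Matrix.kroneckerMap_apply, Matrix.transpose_apply]
  fun_prop

lemma continuous_gram (φ : Module.Basis (Fin r) ℝ (linSpace S)) : Continuous (gram φ) :=
  ((continuous_const.matrix_mul continuous_Delta.matrix_transpose).matrix_mul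
    continuous_Delta).matrix_mul continuous_const

lemma continuousAt_matrix_inv {n : Type*} [Fintype n] [DecidableEq n] {A : Matrix n n ℝ}
    (hA : IsUnit A) : ContinuousAt (fun M : Matrix n n ℝ => M⁻¹) A := by
  simp only [Matrix.inv_def, Ring.inverse_eq_inv']
  have hdet : A.det ≠ 0 := ((Matrix.isUnit_iff_isUnit_det _).1 hA).ne_zero
  exact ((continuous_id.matrix_det.continuousAt).inv₀ hdet).smul
    continuous_id.matrix_adjugate.continuousAt

lemma continuousAt_gram_inv {φ : Module.Basis (Fin r) ℝ (linSpace S)} (h : IsUnit (gram φ Q)) :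
    ContinuousAt (fun A => (gram φ A)⁻¹) Q :=
  ContinuousAt.comp (f := gram φ) (continuousAt_matrix_inv h) (continuous_gram φ).continuousAt

lemma eventually_isUnit_gram {φ : Module.Basis (Fin r) ℝ (linSpace S)} (h : IsUnit (gram φ Q)) :
    ∀ᶠ A in 𝓝 Q, IsUnit (gram φ A) := by
  have hdet : (gram φ Q).det ≠ 0 := ((Matrix.isUnit_iff_isUnit_det _).1 h).ne_zero
  filter_upwards [(continuous_gram φ).matrix_det.continuousAt.eventually_ne hdet] with A hA
  exact (Matrix.isUnit_iff_isUnit_det _).2 (isUnit_iff_ne_zero.2 hA)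

lemma continuousAt_matrix_mul {X l m n : Type*} [TopologicalSpace X] [Fintype m]
    {f : X → Matrix l m ℝ} {g : X → Matrix m n ℝ} {x : X} (hf : ContinuousAt f x)
    (hg : ContinuousAt g x) : ContinuousAt (fun x => f x * g x) x :=
  ContinuousAt.comp (f := fun x => (f x, g x))
    (g := fun p : Matrix l m ℝ × Matrix m n ℝ => p.1 * p.2)
    (continuous_fst.matrix_mul continuous_snd).continuousAt (hf.prodMk hg)

lemma continuousAt_BMat {φ : Module.Basis (Fin r) ℝ (linSpace S)} (h : IsUnit (gram φ Q)) :
    ContinuousAt (BMat φ P) Q :=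
  continuousAt_matrix_mul (continuousAt_matrix_mul (continuousAt_matrix_mul
    (continuousAt_matrix_mul continuousAt_const (continuousAt_gram_inv h)) continuousAt_const)
    continuous_Delta.matrix_transpose.continuousAt) continuousAt_const

lemma continuousAt_estimator {φ : Module.Basis (Fin r) ℝ (linSpace S)} (h : IsUnit (gram φ Q)) :
    ContinuousAt (estimator φ P₀) Q := by
  have h1 : ContinuousAt (fun A => 1 - PhiMat φ * (gram φ A)⁻¹ * (PhiMat φ).transpose
      * (Delta A).transpose * Delta A) Q :=
    continuousAt_const.sub (continuousAt_matrix_mul (continuousAt_matrix_mul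
      (continuousAt_matrix_mul (continuousAt_matrix_mul continuousAt_const
      (continuousAt_gram_inv h)) continuousAt_const)
      continuous_Delta.matrix_transpose.continuousAt) continuous_Delta.continuousAt)
  have h2 : Continuous fun M : Matrix (Fin N × Fin N) (Fin N × Fin N) ℝ =>
      WithLp.toLp 2 (M.mulVec (Matrix.vec P₀)) :=
    (PiLp.continuous_toLp 2 _).comp (continuous_id.matrix_mulVec continuous_const)
  exact ContinuousAt.comp (f := fun A => 1 - PhiMat φ * (gram φ A)⁻¹ * (PhiMat φ).transpose
      * (Delta A).transpose * Delta A) h2.continuousAt h1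

variable {π : Fin N → ℝ}

/-- The quadratic form of `Σ` is a variance. -/
lemma SigmaMat_quadForm (hQ : Q ∈ Matrix.rowStochastic ℝ (Fin N)) (hπ : ∀ i, 0 < π i)
    (x : Fin N × Fin N → ℝ) :
    x ⬝ᵥ (SigmaMat π Q).mulVec x = ∑ i, π i * ∑ j, Q i j *
      ((x (j, i) - ∑ l, Q i l * x (l, i)) / π i) ^ 2 := by
  have hS : ∀ a b : Fin N × Fin N, SigmaMat π Q a b
      = if a.2 = b.2 then ((if a.1 = b.1 then Q a.2 a.1 else 0) - Q a.2 a.1 * Q a.2 b.1) / π a.2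
        else 0 := by
    rintro ⟨j, i⟩ ⟨l, k⟩
    simp only [SigmaMat, Matrix.of_apply, Prod.mk.injEq]
    by_cases h1 : i = k <;> by_cases h2 : j = l <;> simp [h1, h2]
    ring
  simp only [dotProduct, Matrix.mulVec, hS, Fintype.sum_prod_type_right]
  refine Finset.sum_congr rfl fun i _ => ?_
  set m := ∑ l, Q i l * x (l, i) with hm
  have e1 : ∀ j, ∑ k, ∑ l, (if i = k then ((if j = l then Q i j else 0) - Q i j * Q i l) / π i
      else 0) * x (l, k) = Q i j * (x (j, i) - m) / π i := by
    intro j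
    rw [Finset.sum_eq_single i (fun k _ hk => by simp [Ne.symm hk]) (by simp)]
    simp only [if_true, sub_div, sub_mul, Finset.sum_sub_distrib, ite_div, ite_mul, zero_div,
      zero_mul, Finset.sum_ite_eq, Finset.mem_univ, hm, Finset.mul_sum, mul_sub, Finset.sum_div]
    congr 1
    · ring
    · exact Finset.sum_congr rfl fun l _ => by ring
  simp only [e1]
  have hπi := (hπ i).ne'
  have e2 : ∑ j, Q i j * (x (j, i) - m) = 0 := by
    simp only [mul_sub, Finset.sum_sub_distrib, ← Finset.sum_mul,
      Matrix.sum_row_of_mem_rowStochastic hQ, ← hm]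
    ring
  -- One factor `x (j, i)` may be centred at `m` for free, because the weights of the other factor
  -- sum to zero by `e2`.
  have e3 : ∑ j, x (j, i) * (Q i j * (x (j, i) - m) / π i)
      = ∑ j, Q i j * (x (j, i) - m) ^ 2 / π i + m / π i * ∑ j, Q i j * (x (j, i) - m) := by
    rw [Finset.mul_sum, ← Finset.sum_add_distrib]
    exact Finset.sum_congr rfl fun j _ => by ring
  rw [e3, e2, mul_zero, add_zero, Finset.mul_sum]
  exact Finset.sum_congr rfl fun j _ => by field_simp

lemma SigmaMat_posSemidef (hQ : Q ∈ Matrix.rowStochastic ℝ (Fin N)) (hπ : ∀ i, 0 < π i) :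
    (SigmaMat π Q).PosSemidef := by
  refine Matrix.PosSemidef.of_dotProduct_mulVec_nonneg ?_ fun x => ?_
  · refine Matrix.IsHermitian.ext fun a b => ?_
    obtain ⟨j, i⟩ := a
    obtain ⟨l, k⟩ := b
    simp only [SigmaMat, Matrix.of_apply, Prod.mk.injEq, star_trivial]
    by_cases h1 : i = k
    · subst h1
      by_cases h2 : j = l
      · simp [h2]
      · simp [h2, Ne.symm h2, mul_comm]
    · simp [h1, Ne.symm h1]
  · rw [star_trivial, SigmaMat_quadForm hQ hπ]
    exact Finset.sum_nonneg fun i _ => mul_nonneg (hπ i).le (Finset.sum_nonneg fun j _ =>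
      mul_nonneg (Matrix.nonneg_of_mem_rowStochastic hQ) (sq_nonneg _))

end LinearAlgebra


/-! ### Tools for convergence in probability and in distribution -/

section Convergence

variable {Ω : Type*} [MeasurableSpace Ω] {Pr : Measure Ω}

lemma tendstoInMeasure_pi {ι E : Type*} [Fintype ι] [PseudoEMetricSpace E]
    {f : ℕ → Ω → ι → E} {g : Ω → ι → E}
    (h : ∀ i, TendstoInMeasure Pr (fun n ω => f n ω i) atTop fun ω => g ω i) :
    TendstoInMeasure Pr f atTop g := by
  intro ε hε
  have hsum : Tendsto (fun n => ∑ i, Pr {ω | ε ≤ edist (f n ω i) (g ω i)}) atTop (𝓝 0) := by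
    simpa using tendsto_finsetSum Finset.univ fun i _ => h i ε hε
  refine tendsto_of_tendsto_of_tendsto_of_le_of_le tendsto_const_nhds hsum
    (fun _ => zero_le) fun n => ?_
  refine (measure_mono fun ω hω => ?_).trans
    (measure_iUnion_fintype_le Pr fun i => {ω | ε ≤ edist (f n ω i) (g ω i)})
  by_contra hc
  simp only [Set.mem_iUnion, Set.mem_ofPred_eq, not_exists, not_le] at hc hω
  rw [edist_pi_def] at hω
  exact absurd ((Finset.sup_lt_iff (by simpa using hε)).2 fun i _ => hc i) (not_lt.2 hω)

lemma tendsto_measure_notMem_of_tendstoInMeasure {E : Type*} [PseudoEMetricSpace E]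
    {f : ℕ → Ω → E} {c : E} (h : TendstoInMeasure Pr f atTop fun _ => c) {s : Set E}
    (hs : s ∈ 𝓝 c) : Tendsto (fun n => Pr {ω | f n ω ∉ s}) atTop (𝓝 0) := by
  obtain ⟨δ, hδ, hball⟩ := EMetric.mem_nhds_iff.1 hs
  refine tendsto_of_tendsto_of_tendsto_of_le_of_le tendsto_const_nhds (h δ hδ)
    (fun _ => zero_le) fun n => measure_mono fun ω hω => ?_
  by_contra hc
  have hlt : edist (f n ω) c < δ := not_le.1 hc
  exact hω (hball hlt)

lemma tendstoInMeasure_comp_continuousAt {E F : Type*} [PseudoEMetricSpace E]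
    [PseudoEMetricSpace F] {f : ℕ → Ω → E} {c : E} (h : TendstoInMeasure Pr f atTop fun _ => c)
    {g : E → F} (hg : ContinuousAt g c) :
    TendstoInMeasure Pr (fun n ω => g (f n ω)) atTop fun _ => g c := by
  intro ε hε
  have := tendsto_measure_notMem_of_tendstoInMeasure h (hg (Metric.eball_mem_nhds (g c) hε))
  refine this.congr fun n => ?_
  congr 1
  ext ω
  simp

lemma tendstoInMeasure_sub_of_eq_on {E : Type*} [SeminormedAddCommGroup E] {f g : ℕ → Ω → E}
    {s : ℕ → Set Ω} (hs : Tendsto (fun n => Pr (s n)) atTop (𝓝 0))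
    (h : ∀ᶠ n in atTop, ∀ ω ∉ s n, f n ω = g n ω) :
    TendstoInMeasure Pr (f - g) atTop 0 := by
  intro ε hε
  refine tendsto_of_tendsto_of_tendsto_of_le_of_le' tendsto_const_nhds hs
    (Eventually.of_forall fun _ => zero_le) ?_
  filter_upwards [h] with n hn
  refine measure_mono fun ω hω => ?_
  by_contra hωs
  have : ε ≤ edist (f n ω - g n ω) 0 := hω
  rw [hn ω hωs, sub_self, edist_self] at this
  exact absurd hε (not_lt.2 this)

/-- Only the law of the limit matters. This replaces a limit given as a function of a Gaussian
vector by the identity under the image law. -/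
lemma TendstoInDistribution.of_map_eq {ι Ω' Ω'' E : Type*} [MeasurableSpace Ω']
    [MeasurableSpace Ω''] {μ' : Measure Ω'} {μ'' : Measure Ω''} [IsProbabilityMeasure Pr]
    [IsProbabilityMeasure μ'] [IsProbabilityMeasure μ''] [MeasurableSpace E] [TopologicalSpace E]
    [OpensMeasurableSpace E] {X : ι → Ω → E} {l : Filter ι} {Z : Ω' → E} {Z' : Ω'' → E}
    (h : TendstoInDistribution X l Z (fun _ => Pr) μ') (hZ' : AEMeasurable Z' μ'')
    (hmap : μ'.map Z = μ''.map Z') : TendstoInDistribution X l Z' (fun _ => Pr) μ'' where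
  forall_aemeasurable := h.forall_aemeasurable
  aemeasurable_limit := hZ'
  tendsto := by
    have e : (⟨μ'.map Z, Measure.isProbabilityMeasure_map h.aemeasurable_limit⟩ :
        ProbabilityMeasure E) = ⟨μ''.map Z', Measure.isProbabilityMeasure_map hZ'⟩ :=
      Subtype.ext hmap
    rw [← e]
    exact h.tendsto

/-- Characteristic functions agree, since moving `B` across the inner product evaluates that of the
source at `Bᵀ u`. Singular covariances are included. -/
lemma map_mulVec_multivariateGaussian {ι : Type*} [Fintype ι] [DecidableEq ι]
    {A : Matrix ι ι ℝ} (hA : A.PosSemidef) (B : Matrix ι ι ℝ) :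
    (multivariateGaussian 0 A).map (fun w : EuclideanSpace ℝ ι => WithLp.toLp 2 (B.mulVec w))
      = multivariateGaussian 0 (B * A * B.transpose) := by
  have hBA : (B * A * B.transpose).PosSemidef := by
    have := hA.mul_mul_conjTranspose_same B
    rwa [Matrix.conjTranspose_eq_transpose_of_trivial] at this
  have hcont : Continuous fun w : EuclideanSpace ℝ ι => WithLp.toLp 2 (B.mulVec w) :=
    (PiLp.continuous_toLp 2 _).comp
      (continuous_const.matrix_mulVec (PiLp.continuous_ofLp 2 _))
  have : IsProbabilityMeasure ((multivariateGaussian 0 A).map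
      fun w : EuclideanSpace ℝ ι => WithLp.toLp 2 (B.mulVec w)) :=
    Measure.isProbabilityMeasure_map hcont.measurable.aemeasurable
  refine Measure.ext_of_charFun (funext fun u => ?_)
  have h1 := charFun_multivariateGaussian (μ := 0) hA (WithLp.toLp 2 (B.transpose.mulVec u))
  rw [charFun_multivariateGaussian hBA, charFun_apply, integral_map hcont.measurable.aemeasurable
    (by fun_prop)]
  rw [charFun_apply] at h1
  have h2 : ∀ w : EuclideanSpace ℝ ι,
      inner ℝ (WithLp.toLp 2 (B.mulVec w) : EuclideanSpace ℝ ι) u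
        = inner ℝ w (WithLp.toLp 2 (B.transpose.mulVec u) : EuclideanSpace ℝ ι) := by
    intro w
    simp only [EuclideanSpace.inner_eq_star_dotProduct, star_trivial]
    rw [Matrix.mulVec_transpose, ← Matrix.dotProduct_mulVec]
  simp_rw [h2]
  rw [h1]
  simp only [inner_zero_right]
  congr 3
  rw [Matrix.mulVec_transpose, ← Matrix.mulVec_mulVec, Matrix.mulVec_transpose,
    ← Matrix.mulVec_mulVec, Matrix.dotProduct_mulVec u.ofLp B]

end Convergence

/-! ### Empirical frequencies and their fluctuations -/

section Empirical

variable {N : ℕ} {Ω : Type*}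

/-- The number of transitions `i → j` among the first `n - 1` ones, divided by `n`. -/
noncomputable def pairFreq (Y : ℕ → Ω → Fin N) (n : ℕ) (ω : Ω) : Fin N → Fin N → ℝ := fun i j =>
  pathSum (fun a b => if a = i ∧ b = j then 1 else 0) (n - 1) (fun m => Y m ω) / n

/-- Normalization of the rows. -/
noncomputable def rowNormalize (p : Fin N → Fin N → ℝ) : Matrix (Fin N) (Fin N) ℝ :=
  Matrix.of fun i j => p i j / ∑ l, p i l

lemma sum_pairFreq (Y : ℕ → Ω → Fin N) (n : ℕ) (ω : Ω) (i : Fin N) :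
    ∑ l, pairFreq Y n ω i l
      = (∑ k ∈ Finset.range (n - 1), if Y k ω = i then (1 : ℝ) else 0) / n := by
  simp only [pairFreq, pathSum, ← Finset.sum_div]
  rw [Finset.sum_comm]
  congr 1
  refine Finset.sum_congr rfl fun k _ => ?_
  by_cases h : Y k ω = i <;> simp [h]

/-- Exhibits the empirical matrix as one fixed function of the frequencies, ready for continuous
mapping. The convention `0 / 0 = 0` is the same on both sides. -/
lemma empirical_eq_rowNormalize (Y : ℕ → Ω → Fin N) (n : ℕ) (ω : Ω) :
    empirical Y n ω = rowNormalize (pairFreq Y n ω) := by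
  ext i j
  simp only [empirical, rowNormalize, Matrix.of_apply, sum_pairFreq]
  simp only [pairFreq, pathSum]
  rcases Nat.eq_zero_or_pos n with rfl | hn
  · simp
  · rw [div_div_div_cancel_right₀ (by positivity)]

variable {Q : Matrix (Fin N) (Fin N) ℝ} {π : Fin N → ℝ}

lemma rowNormalize_stationary (hQ : Q ∈ Matrix.rowStochastic ℝ (Fin N)) (hπ : ∀ i, 0 < π i) :
    rowNormalize (fun i j => π i * Q i j) = Q := by
  ext i j
  simp only [rowNormalize, Matrix.of_apply, ← Finset.mul_sum,
    Matrix.sum_row_of_mem_rowStochastic hQ, mul_one]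
  exact mul_div_cancel_left₀ _ (hπ i).ne'

lemma continuousAt_rowNormalize {p : Fin N → Fin N → ℝ} (hp : ∀ i, ∑ l, p i l ≠ 0) :
    ContinuousAt rowNormalize p := by
  refine continuousAt_pi.2 fun i => continuousAt_pi.2 fun j => ?_
  have h1 : Continuous fun p : Fin N → Fin N → ℝ => p i j := by fun_prop
  have h2 : Continuous fun p : Fin N → Fin N → ℝ => ∑ l, p i l := by fun_prop
  exact h1.continuousAt.div h2.continuousAt (hp i)

/-- A path is viewed as a process on the one-point space `Unit`. As `G` is arbitrary, measurability
of anything computed from the frequencies follows without analysing the matrix inverse. -/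
lemma dependsOn_pairFreq {β : Type*} (n : ℕ) (G : (Fin N → Fin N → ℝ) → β) :
    DependsOn (fun x : ℕ → Fin N => G (pairFreq (fun m (_ : Unit) => x m) n ()))
      (Set.Iic (n - 1)) := by
  intro x y hxy
  simp only
  congr 1
  ext i j
  simp only [pairFreq]
  rw [dependsOn_pathSum _ (n - 1) hxy]

/-- The normalized fluctuations of the transition counts, divided by the stationary weights. -/
noncomputable def fluctuation (π : Fin N → ℝ) (Q : Matrix (Fin N) (Fin N) ℝ) (Y : ℕ → Ω → Fin N)
    (n : ℕ) (ω : Ω) : EuclideanSpace ℝ (Fin N × Fin N) :=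
  WithLp.toLp 2 fun x => (√n)⁻¹ * pathSum (fun a b =>
    ((if a = x.2 ∧ b = x.1 then 1 else 0) - Q x.2 x.1 * if a = x.2 then 1 else 0) / π x.2)
    (n - 1) fun m => Y m ω

/-- Reduces the multivariate limit to scalar ones: each projection is a transition sum whose summand
has conditional mean zero and whose stationary variance is the quadratic form of `Σ`. -/
lemma inner_fluctuation (Y : ℕ → Ω → Fin N) (n : ℕ) (ω : Ω) (u : EuclideanSpace ℝ (Fin N × Fin N)) :
    inner ℝ (fluctuation π Q Y n ω) u = (√n)⁻¹ * pathSum (fun i j =>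
      (u (j, i) - ∑ l, Q i l * u (l, i)) / π i) (n - 1) fun m => Y m ω := by
  simp only [PiLp.inner_apply, fluctuation, pathSum, RCLike.inner_apply, conj_trivial]
  simp only [Finset.mul_sum]
  rw [Finset.sum_comm]
  refine Finset.sum_congr rfl fun k _ => ?_
  simp only [Fintype.sum_prod_type_right]
  rw [Finset.sum_eq_single (Y k ω) (fun i _ hi => by simp [Ne.symm hi]) (by simp)]
  simp only [true_and, if_true, mul_one, sub_div, mul_sub, Finset.sum_sub_distrib]
  congr 1
  · rw [Finset.sum_eq_single (Y (k + 1) ω) (fun i _ hi => by simp [Ne.symm hi]) (by simp)]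
    simp
    ring
  · rw [Finset.sum_div, Finset.mul_sum]
    exact Finset.sum_congr rfl fun l _ => by ring

variable [MeasurableSpace Ω]

lemma measurable_comp_pairFreq {Y : ℕ → Ω → Fin N} (hY : ∀ m, Measurable (Y m)) {β : Type*}
    [MeasurableSpace β] (n : ℕ) (G : (Fin N → Fin N → ℝ) → β) :
    Measurable fun ω => G (pairFreq Y n ω) :=
  measurable_of_dependsOn hY (dependsOn_pairFreq n G)

lemma measurable_fluctuation {Y : ℕ → Ω → Fin N} (hY : ∀ m, Measurable (Y m)) (n : ℕ) :
    Measurable (fluctuation π Q Y n) := by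
  refine measurable_of_dependsOn hY (k := n - 1)
    (G := fun x => fluctuation π Q (fun m (_ : Unit) => x m) n ()) fun x y hxy => ?_
  simp only [fluctuation]
  congr 1
  ext z
  rw [dependsOn_pathSum _ (n - 1) hxy]

variable {Pr : Measure Ω} [IsProbabilityMeasure Pr] {Y : ℕ → Ω → Fin N}

/-- Multivariate central limit theorem for the transition counts. -/
theorem tendstoInDistribution_fluctuation (hQ : Q ∈ Matrix.rowStochastic ℝ (Fin N))
    {K : ℕ} (hK : ∀ i j, 0 < (Q ^ K) i j)
    (hπ : π ∈ stdSimplex ℝ (Fin N)) (hπQ : Matrix.vecMul π Q = π)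
    (hY : IsMarkovChain Pr Q Y) :
    TendstoInDistribution (fluctuation π Q Y) atTop id (fun _ => Pr)
      (multivariateGaussian 0 (SigmaMat π Q)) where
  forall_aemeasurable n := (measurable_fluctuation hY.measurable n).aemeasurable
  aemeasurable_limit := aemeasurable_id
  tendsto := by
    have hpos := invariant_pos hπ hπQ hK
    refine ProbabilityMeasure.tendsto_of_tendsto_charFun fun u => ?_
    have hf : ∀ i, ∑ j, Q i j * ((u (j, i) - ∑ l, Q i l * u (l, i)) / π i) = 0 := by
      intro i
      simp only [← mul_div_assoc, ← Finset.sum_div, mul_sub, Finset.sum_sub_distrib,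
        ← Finset.sum_mul, Matrix.sum_row_of_mem_rowStochastic hQ]
      ring
    have h := tendsto_charFun_pathSum hQ hK hπ hπQ hY hf
    have e1 : charFun ((multivariateGaussian 0 (SigmaMat π Q)).map id) u
        = Complex.exp (-((∑ i, π i * ∑ j, Q i j *
          ((u (j, i) - ∑ l, Q i l * u (l, i)) / π i) ^ 2 : ℝ) : ℂ) / 2) := by
      rw [Measure.map_id, charFun_multivariateGaussian (SigmaMat_posSemidef hQ hpos),
        SigmaMat_quadForm hQ hpos]
      congr 1
      simp
      ring
    have e2 : ∀ n, charFun (Pr.map (fluctuation π Q Y n)) u = ∫ ω, Complex.exp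
        (((√n)⁻¹ * pathSum (fun i j => (u (j, i) - ∑ l, Q i l * u (l, i)) / π i) (n - 1)
          (fun m => Y m ω) : ℝ) * Complex.I) ∂Pr := by
      intro n
      rw [charFun_apply, integral_map (measurable_fluctuation hY.measurable n).aemeasurable
        (by fun_prop)]
      simp_rw [inner_fluctuation]
    simp only [ProbabilityMeasure.coe_mk]
    rw [e1]
    simp_rw [e2]
    exact h

lemma tendstoInMeasure_pairFreq (hQ : Q ∈ Matrix.rowStochastic ℝ (Fin N))
    {K : ℕ} (hK : ∀ i j, 0 < (Q ^ K) i j)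
    (hπ : π ∈ stdSimplex ℝ (Fin N)) (hπQ : Matrix.vecMul π Q = π)
    (hY : IsMarkovChain Pr Q Y) :
    TendstoInMeasure Pr (pairFreq Y) atTop fun _ i j => π i * Q i j := by
  refine tendstoInMeasure_pi fun i => tendstoInMeasure_pi fun j => ?_
  have h := tendstoInMeasure_transition_average hQ hK hπ hπQ hY
    fun a b => if a = i ∧ b = j then 1 else 0
  have e : ∑ a, π a * ∑ b, Q a b * (if a = i ∧ b = j then (1 : ℝ) else 0) = π i * Q i j := by
    rw [Finset.sum_eq_single i (fun a _ ha => by simp [ha]) (by simp)]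
    simp
  rw [e] at h
  exact h

end Empirical

/-! ### Asymptotics of the estimator -/

section Estimator

variable {N r : ℕ} {Ω : Type*} {P P₀ Q : Matrix (Fin N) (Fin N) ℝ} {π : Fin N → ℝ}
  {Y : ℕ → Ω → Fin N} {S : Set (Fin N × Fin N)}

/-- The random matrix that turns the fluctuations into the normalized estimation error. -/
noncomputable def errorMatrix (φ : Module.Basis (Fin r) ℝ (linSpace S))
    (P : Matrix (Fin N) (Fin N) ℝ) (π : Fin N → ℝ) (p : Fin N → Fin N → ℝ) :
    Fin N × Fin N → Fin N × Fin N → ℝ :=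
  (BMat φ P (rowNormalize p) * Matrix.diagonal fun x => π x.2 / ∑ l, p x.2 l :)

/-- Row `i` of the error is the centred count divided by the number of transitions from `i`, whereas
`fluctuation` divides by `π i`. The diagonal matrix is the exact correction. -/
lemma rowNormalize_error (hπ : ∀ i, 0 < π i) {n : ℕ} (hn : 0 < n) {ω : Ω}
    (hp : ∀ i, ∑ l, pairFreq Y n ω i l ≠ 0) :
    √n • Matrix.vec (rowNormalize (pairFreq Y n ω) - Q)
      = (Matrix.diagonal fun x : Fin N × Fin N => π x.2 / ∑ l, pairFreq Y n ω x.2 l).mulVec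
        (fluctuation π Q Y n ω).ofLp := by
  ext ⟨j, i⟩
  have hn' : (0 : ℝ) < n := by exact_mod_cast hn
  have hs : √(n : ℝ) * √n = n := Real.mul_self_sqrt hn'.le
  have hs0 : √(n : ℝ) ≠ 0 := (Real.sqrt_pos.2 hn').ne'
  have e : pathSum (fun a b => ((if a = i ∧ b = j then 1 else 0)
      - Q i j * if a = i then 1 else 0) / π i) (n - 1) (fun m => Y m ω)
      = n * (pairFreq Y n ω i j - Q i j * ∑ l, pairFreq Y n ω i l) / π i := by
    rw [sum_pairFreq]
    simp only [pairFreq, pathSum, ← Finset.sum_div, Finset.sum_sub_distrib, ← Finset.mul_sum]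
    congr 1
    field_simp
  have hpi := hp i
  have hπi := (hπ i).ne'
  rw [Matrix.mulVec_diagonal]
  simp only [fluctuation, e, Pi.smul_apply, Matrix.vec, Matrix.sub_apply, rowNormalize,
    Matrix.of_apply, smul_eq_mul]
  have e2 : (√(n : ℝ))⁻¹ * n = √n := by
    rw [inv_mul_eq_div, div_eq_iff hs0, hs]
  have e3 : (√(n : ℝ))⁻¹ * (n * (pairFreq Y n ω i j - Q i j * ∑ l, pairFreq Y n ω i l) / π i)
      = √n * ((pairFreq Y n ω i j - Q i j * ∑ l, pairFreq Y n ω i l) / π i) := by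
    rw [mul_div_assoc, ← mul_assoc, e2]
  rw [e3]
  field_simp

variable [MeasurableSpace Ω] {Pr : Measure Ω} [IsProbabilityMeasure Pr]

/-- Consistency and asymptotic normality of the estimator along an observed ergodic chain. -/
theorem estimator_asymptotics (hQ : Q ∈ Matrix.rowStochastic ℝ (Fin N))
    {K : ℕ} (hK : ∀ i j, 0 < (Q ^ K) i j)
    (hπ : π ∈ stdSimplex ℝ (Fin N)) (hπQ : Matrix.vecMul π Q = π)
    (hY : IsMarkovChain Pr Q Y) (hid : Identifiable S P Q) (hP₀ : P₀ ∈ affineSet S)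
    (φ : Module.Basis (Fin r) ℝ (linSpace S)) :
    Tendsto (fun n : ℕ => Pr {ω | IsUnit (gram φ (empirical Y n ω))}) atTop (𝓝 1) ∧
    TendstoInMeasure Pr (fun (n : ℕ) ω => estimator φ P₀ (empirical Y n ω)) atTop
      (fun _ => WithLp.toLp 2 (Matrix.vec P)) ∧
    TendstoInDistribution
      (fun (n : ℕ) ω => √n • (estimator φ P₀ (empirical Y n ω) - WithLp.toLp 2 (Matrix.vec P)))
      atTop id (fun _ => Pr)
      (multivariateGaussian 0 (BMat φ P Q * SigmaMat π Q * (BMat φ P Q).transpose)) := by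
  have hpos := invariant_pos hπ hπQ hK
  have hgram := isUnit_gram hid φ
  have hP := mem_affineSet_of_identifiable hid
  have hcomm := commute_of_identifiable hid
  set p₀ : Fin N → Fin N → ℝ := fun i j => π i * Q i j with hp₀
  have hsum₀ : ∀ i, ∑ l, p₀ i l = π i := fun i => by
    simp only [hp₀, ← Finset.mul_sum, Matrix.sum_row_of_mem_rowStochastic hQ, mul_one]
  have hsum₀' : ∀ i, ∑ l, p₀ i l ≠ 0 := fun i => by rw [hsum₀]; exact (hpos i).ne'
  have hnorm : rowNormalize p₀ = Q := rowNormalize_stationary hQ hpos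
  have hfreq : TendstoInMeasure Pr (pairFreq Y) atTop fun _ => p₀ :=
    tendstoInMeasure_pairFreq hQ hK hπ hπQ hY
  have hcn : ContinuousAt rowNormalize p₀ := continuousAt_rowNormalize hsum₀'
  simp_rw [empirical_eq_rowNormalize]
  have hunit : {p | IsUnit (gram φ (rowNormalize p))} ∈ 𝓝 p₀ := by
    have h : ∀ᶠ A in 𝓝 (rowNormalize p₀), IsUnit (gram φ A) := by
      rw [hnorm]
      exact eventually_isUnit_gram hgram
    exact hcn.eventually h
  have hrow : {p : Fin N → Fin N → ℝ | ∀ i, ∑ l, p i l ≠ 0} ∈ 𝓝 p₀ := by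
    refine eventually_all.2 fun i => ?_
    have : Continuous fun p : Fin N → Fin N → ℝ => ∑ l, p i l := by fun_prop
    exact this.continuousAt.eventually_ne (hsum₀' i)
  have hest : estimator φ P₀ Q = WithLp.toLp 2 (Matrix.vec P) := by
    have := estimator_sub φ hP hP₀ hcomm hgram
    rw [sub_self, Matrix.vec_zero, Matrix.mulVec_zero, WithLp.toLp_zero] at this
    exact sub_eq_zero.1 this
  refine ⟨?_, ?_, ?_⟩
  · have h0 := tendsto_measure_notMem_of_tendstoInMeasure hfreq hunit
    have h1 := ENNReal.Tendsto.sub (tendsto_const_nhds (x := (1 : ENNReal))) h0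
      (Or.inl ENNReal.one_ne_top)
    rw [tsub_zero] at h1
    refine tendsto_of_tendsto_of_tendsto_of_le_of_le h1 tendsto_const_nhds (fun n => ?_)
      fun n => prob_le_one
    -- Subadditivity over the event and its complement suffices; no measurability is needed.
    rw [tsub_le_iff_right, ← measure_univ (μ := Pr)]
    refine (measure_mono fun ω _ => ?_).trans (measure_union_le _ _)
    exact em (IsUnit (gram φ (rowNormalize (pairFreq Y n ω))))
  · have hc : ContinuousAt (fun p => estimator φ P₀ (rowNormalize p)) p₀ :=
      ContinuousAt.comp (g := estimator φ P₀) (f := rowNormalize)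
        (by rw [hnorm]; exact continuousAt_estimator hgram) hcn
    have := tendstoInMeasure_comp_continuousAt hfreq hc
    simpa only [hnorm, hest] using this
  · have hW := tendstoInDistribution_fluctuation hQ hK hπ hπQ hY
    have hC0 : errorMatrix φ P π p₀ = BMat φ P Q := by
      have : (fun x : Fin N × Fin N => π x.2 / ∑ l, p₀ x.2 l) = 1 := by
        ext x
        rw [hsum₀, div_self (hpos _).ne', Pi.one_apply]
      change BMat φ P (rowNormalize p₀)
        * (Matrix.diagonal fun x : Fin N × Fin N => π x.2 / ∑ l, p₀ x.2 l) = BMat φ P Q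
      rw [hnorm, this, show Matrix.diagonal (1 : Fin N × Fin N → ℝ) = 1 from Matrix.diagonal_one,
        Matrix.mul_one]
    have hCc : ContinuousAt (errorMatrix φ P π) p₀ := by
      refine continuousAt_matrix_mul (f := fun p => BMat φ P (rowNormalize p))
        (g := fun p => Matrix.diagonal fun x : Fin N × Fin N => π x.2 / ∑ l, p x.2 l)
        (ContinuousAt.comp (g := BMat φ P) (f := rowNormalize)
          (by rw [hnorm]; exact continuousAt_BMat hgram) hcn) ?_
      refine ContinuousAt.comp (f := fun (p : Fin N → Fin N → ℝ) (x : Fin N × Fin N) =>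
        π x.2 / ∑ l, p x.2 l) (continuous_id.matrix_diagonal).continuousAt
        (continuousAt_pi.2 fun x => ?_)
      have : Continuous fun p : Fin N → Fin N → ℝ => ∑ l, p x.2 l := by fun_prop
      exact continuousAt_const.div this.continuousAt (hsum₀' x.2)
    have hCt := tendstoInMeasure_comp_continuousAt hfreq hCc
    have hg : Continuous fun q : EuclideanSpace ℝ (Fin N × Fin N)
        × (Fin N × Fin N → Fin N × Fin N → ℝ) =>
        (WithLp.toLp 2 (Matrix.mulVec (q.2 : Matrix _ _ ℝ) q.1.ofLp) :
          EuclideanSpace ℝ (Fin N × Fin N)) :=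
      (PiLp.continuous_toLp 2 _).comp
        (Continuous.matrix_mulVec (A := fun q : EuclideanSpace ℝ (Fin N × Fin N)
          × (Fin N × Fin N → Fin N × Fin N → ℝ) => (q.2 : Matrix _ _ ℝ)) continuous_snd
          ((PiLp.continuous_ofLp 2 _).comp continuous_fst))
    -- Slutsky's theorem: the fluctuations converge in law and the random matrix in probability to a
    -- constant.
    have hslut := hW.continuous_comp_prodMk_of_tendstoInMeasure_const hg hCt fun n =>
      (measurable_comp_pairFreq hY.measurable n _).aemeasurable
    have hlim : TendstoInDistribution (fun n ω => (WithLp.toLp 2 (Matrix.mulVec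
        (errorMatrix φ P π (pairFreq Y n ω) : Matrix _ _ ℝ) (fluctuation π Q Y n ω).ofLp) :
          EuclideanSpace ℝ (Fin N × Fin N))) atTop id (fun _ => Pr)
        (multivariateGaussian 0 (BMat φ P Q * SigmaMat π Q * (BMat φ P Q).transpose)) := by
      refine TendstoInDistribution.of_map_eq hslut aemeasurable_id ?_
      rw [Measure.map_id, ← map_mulVec_multivariateGaussian (SigmaMat_posSemidef hQ hpos), hC0]
      rfl
    -- The exact error formula holds outside an event of vanishing probability, where the Gram
    -- matrix may be singular or a state unvisited.
    refine tendstoInDistribution_of_tendstoInMeasure_sub _ _ hlim ?_ fun n =>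
      (measurable_comp_pairFreq hY.measurable n fun p =>
        √n • (estimator φ P₀ (rowNormalize p) - WithLp.toLp 2 (Matrix.vec P))).aemeasurable
    refine tendstoInMeasure_sub_of_eq_on
      (tendsto_measure_notMem_of_tendstoInMeasure hfreq (inter_mem hunit hrow)) ?_
    filter_upwards [eventually_gt_atTop 0] with n hn ω hω
    obtain ⟨hω1, hω2⟩ : pairFreq Y n ω ∈ {p | IsUnit (gram φ (rowNormalize p))}
        ∩ {p : Fin N → Fin N → ℝ | ∀ i, ∑ l, p i l ≠ 0} := by
      by_contra hc
      exact hω hc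
    rw [estimator_sub φ hP hP₀ hcomm hω1, ← WithLp.toLp_smul, ← Matrix.mulVec_smul,
      rowNormalize_error hpos hn hω2, Matrix.mulVec_mulVec]
    rfl

/-- If only one matrix has the prescribed support, the estimator is constant. -/
theorem estimator_degenerate (hid : Identifiable S P 1) (hP₀ : P₀ ∈ affineSet S)
    (φ : Module.Basis (Fin r) ℝ (linSpace S)) :
    (∀ A, IsUnit (gram φ A)) ∧
    (∀ A, estimator φ P₀ A = WithLp.toLp 2 (Matrix.vec P)) ∧ ∀ A, BMat φ P A = 0 := by
  have hP := mem_affineSet_of_identifiable hid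
  -- Every matrix commutes with the identity, so a basis vector added to `P` would contradict
  -- identifiability.
  have : IsEmpty (Fin r) := ⟨fun j => φ.ne_zero j (Subtype.ext (by
    have hmem : P + (φ j : Matrix (Fin N) (Fin N) ℝ) ∈ affineSet S ∩ Set.centralizer {1} := by
      refine ⟨add_mem_affineSet hP _, ?_⟩
      rintro _ rfl
      simp
    rw [show affineSet S ∩ Set.centralizer {1} = {P} from hid] at hmem
    simpa using hmem))⟩
  have hunit : ∀ A, IsUnit (gram φ A) := fun A => isUnit_of_subsingleton _
  have hB : ∀ A, BMat φ P A = 0 := fun A => by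
    have : PhiMat φ * (gram φ A)⁻¹ = 0 := by
      ext x j
      exact isEmptyElim j
    rw [BMat, this]
    simp
  refine ⟨hunit, fun A => ?_, hB⟩
  have h := estimator_sub φ hP hP₀ (commute_of_identifiable hid) (hunit A)
  rw [hB, Matrix.zero_mulVec, WithLp.toLp_zero] at h
  exact sub_eq_zero.1 h

end Estimator

end SubsampledChain

/-! ### The theorem -/

open SubsampledChain in
theorem theorem1 {N r : ℕ} (hN : 3 ≤ N)
    {Ω : Type*} [MeasurableSpace Ω] (Pr : Measure Ω) [IsProbabilityMeasure Pr]
    -- the hidden chain: irreducible, aperiodic, with invariant distribution `π`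
    (P : Matrix (Fin N) (Fin N) ℝ) (hP : P ∈ Matrix.rowStochastic ℝ (Fin N))
    (hirr : P.IsIrreducible) (haper : IsAperiodic P)
    (π : Fin N → ℝ) (hπ : π ∈ stdSimplex ℝ (Fin N)) (hπP : Matrix.vecMul π P = π)
    (X : ℕ → Ω → Fin N) (hX : IsMarkovChain Pr P X)
    -- the random observation times
    (μ : PMF ℕ) (τ : ℕ → Ω → ℕ) (hτ : IsSamplingScheme Pr μ X τ)
    -- the known support, the identifiability condition, the base point and the basis
    (S : Set (Fin N × Fin N)) (hid : Identifiable S P (genMatrix μ P))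
    (P₀ : Matrix (Fin N) (Fin N) ℝ) (hP₀ : P₀ ∈ affineSet S)
    (φ : Module.Basis (Fin r) ℝ (linSpace S)) :
    -- the inverse in `B` exists
    IsUnit (gram φ (genMatrix μ P)) ∧
    -- the inverse in the estimator exists with probability tending to one
    Tendsto (fun n : ℕ => Pr {ω | IsUnit (gram φ (empirical (observed X τ) n ω))}) atTop (𝓝 1) ∧
    -- consistency
    TendstoInMeasure Pr (fun (n : ℕ) ω => estimator φ P₀ (empirical (observed X τ) n ω)) atTop
      (fun _ => WithLp.toLp 2 (Matrix.vec P)) ∧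
    -- asymptotic normality
    TendstoInDistribution
      (fun (n : ℕ) ω => Real.sqrt n •
        (estimator φ P₀ (empirical (observed X τ) n ω) - WithLp.toLp 2 (Matrix.vec P)))
      atTop id (fun _ => Pr)
      (multivariateGaussian 0
        (BMat φ P (genMatrix μ P) * SigmaMat π (genMatrix μ P) *
          (BMat φ P (genMatrix μ P)).transpose)) := by
  -- If all gaps vanish almost surely, the observed chain never moves and the limit theorems do not
  -- apply.
  by_cases hμ : μ 0 = 1
  · rw [genMatrix_eq_one hμ] at hid ⊢
    obtain ⟨hunit, hest, hB⟩ := estimator_degenerate hid hP₀ φ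
    refine ⟨hunit _, ?_, ?_, ?_⟩
    · simp [hunit]
    · simp only [hest]
      exact fun ε hε => by simp [hε.not_ge]
    · simp only [hest, hB, sub_self, smul_zero, Matrix.zero_mul]
      -- Here `B = 0`, and the Gaussian law with zero covariance is the point mass at zero.
      refine TendstoInDistribution.of_map_eq
        (tendstoInDistribution_const (Z := fun _ => 0) aemeasurable_const) aemeasurable_id ?_
      simp [multivariateGaussian]
  · obtain ⟨K, hK⟩ := genMatrix_pow_pos hP hirr haper hμ
    exact ⟨isUnit_gram hid φ, estimator_asymptotics (genMatrix_mem_rowStochastic hP) hK hπ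
      (invariant_genMatrix hP hπP) (isMarkovChain_observed hP hX hτ) hid hP₀ φ⟩
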